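/- Let $\mathbb F_q$ be a finite field with $q$ elements, $A=\mathbb F_q[\theta]$, $K=\mathbb F_q(\theta)$, $K_\infty=\mathbb F_q((1/\theta))$ with $|\theta|=q$, $\mathbb C_\infty$ the completion of an algebraic closure of $K_\infty$, and $\Omega=\mathbb C_\infty\setminus K_\infty$. Let $\mathcal O$ be the ring of holomorphic functions on $\Omega$, i.e. of the functions $\Omega\to\mathbb C_\infty$ that are, on each $\Omega_n=\{z\in\Omega: |z|\le q^n,\ \inf_{a\in K_\infty}|z-a|\ge q^{-n}\}$ ($n\ge1$), a uniform limit of rational functions whose poles lie outside $\Omega_n$. Let $\tilde\pi=\theta(-\theta)^{1/(q-1)}\prod_{i\ge1}(1-\theta^{1-q^i})^{-1}$ be the Carlitz period, for a fixed choice of a $(q-1)$-st root of $-\theta$, and let $\exp_C$ be the exponential function of the Carlitz module $C_\theta=\theta+\tau$. For $f\in\mathcal O$ the hyperderivatives $D^nf$ are defined by $f(z+\epsilon)=\sum_{n\ge0}(D^nf)(z)\,\epsilon^n$ for $|\epsilon|$ sufficiently small, and $\partial^n:=\tilde\pi^{-n}D^n$. Let $\widehat{K_\infty^{\mathrm{nr}}}=\overline{\mathbb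 F}_q((1/\theta))\subset\mathbb C_\infty$ and $\sigma\bigl(\sum_{i\ge i_0} a_i\theta^{-i}\bigr)=\sum_{i\ge i_0} a_i^q\theta^{-i}$. Let $M$ be a field with $\widehat{K_\infty^{\mathrm{nr}}}\subseteq M\subseteq\mathbb C_\infty$, let $\psi$ be a continuous automorphism of $\mathbb C_\infty$ over $K_\infty$ whose restriction to $\widehat{K_\infty^{\mathrm{nr}}}$ is $\sigma$, and put $\Omega^\psi(M)=\{z\in M:\psi(z)\ne z\}\subset\Omega$. For $f\in\mathcal O$ and an integer $k\ge0$ define functions on $\Omega^\psi(M)$ by $\delta_k^0f=f$ and, for $r\ge1$, $$(\delta_k^rf)(z)=\sum_{i=0}^r\binom{k+r-1}{i}\frac{(\partial^{r-i}f)(z)}{(\tilde\pi z-\tilde\pi\psi(z))^i}.$$ Let $k,w,r\ge0$ be integers. For $0\le\nu\le r$ put $$\tilde\beta_{r,\nu}=(k+r-1)(k+r-2)\cdots(k+\nu)\,(w+r-1)(w+r-2)\cdots(w+r-\nu),\qquad \beta_{r,\nu}=\frac{\tilde\beta_{r,\nu}}{\gcd_{0\le\mu\le r}\tilde\beta_{r,\mu}}$$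 (if all $\tilde\beta_{r,\nu}$ vanish, which happens only for $k=w=0$, $r=1$, put $\beta_{r,\nu}=0$), and for $f,g\in\mathcal O$ let $$[f,g]_{k,w,r}=\sum_{\nu=0}^r(-1)^{r-\nu}\beta_{r,\nu}\,(\partial^\nu f)(\partial^{r-\nu}g).$$ For a congruence subgroup $\Gamma\subseteq\mathrm{GL}_2(A)$ (a subgroup containing a principal congruence subgroup $\Gamma(\mathfrak n)$ with $\mathfrak n\in A\setminus\mathbb F_q$) let $m_\Gamma\in A$ be the monic generator of the largest ideal $\mathcal I$ with $\begin{pmatrix}1&a\\0&1\end{pmatrix}\in\Gamma$ for all $a\in\mathcal I$, and put $u_{m_\Gamma}(z)=\exp_C(\tilde\pi z/m_\Gamma)^{-1}$. Put $(f|_{k,m}\gamma)(z)=\det(\gamma)^m(cz+d)^{-k}f\bigl(\tfrac{az+b}{cz+d}\bigr)$ for $\gamma=\begin{pmatrix}a&b\\c&d\end{pmatrix}\in\mathrm{GL}_2(A)$, $k\in\mathbb Z$ and $m\in\mathbb Z/(q-1)\mathbb Z$. A Drinfeld modular form of weight $k\in\mathbb Z$ and type $m\in\mathbb Z/(q-1)\mathbb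 Z$ for $\Gamma$ is an $f\in\mathcal O$ such that $f|_{k,m}\gamma=f$ for all $\gamma\in\Gamma$ and such that, for every $\alpha\in\mathrm{GL}_2(A)$, the function $f|_{k,m}\alpha$ has an expansion $\sum_{n\ge0}a_n\,u_{m_{\alpha^{-1}\Gamma\alpha}}(z)^n$ with $a_n\in\mathbb C_\infty$, valid whenever $|u_{m_{\alpha^{-1}\Gamma\alpha}}(z)|$ is sufficiently small. For a field $K\subseteq L\subseteq\mathbb C_\infty$ let $\mathcal M_k^m(\Gamma;L)$ be the $L$-vector space generated by the Drinfeld modular forms of weight $k$ and type $m$ for $\Gamma$ whose $u_{m_\Gamma}$-expansion has coefficients in $L$. Theorem. (1) For all $f,g\in\mathcal O$, on $\Omega^\psi(M)$ we have $$[f,g]_{k,w,r}=\sum_{\nu=0}^r(-1)^{r-\nu}\beta_{r,\nu}\,(\delta_k^\nu f)(\delta_w^{r-\nu}g).$$ (2) For every congruence subgroup $\Gamma$ of $\mathrm{GL}_2(A)$, every field $K\subseteq L\subseteq\mathbb C_\infty$ and all $m_1,m_2\in\mathbb Z/(q-1)\mathbb Z$: if $f\in\mathcal M_k^{m_1}(\Gamma;L)$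 and $g\in\mathcal M_w^{m_2}(\Gamma;L)$, then $[f,g]_{k,w,r}\in\mathcal M_{k+w+2r}^{m_1+m_2+r}(\Gamma;L)$. -/

import Mathlib

/-!
Throughout, `F` is a finite field with `q` elements, `A = F[θ]` is `Polynomial F` with `θ` the
variable, and `K = F(θ)` is `RatFunc F`.
-/

noncomputable section

namespace Drinfeld

open Polynomial Topology
open scoped NNReal WithZero MatrixGroups

/-! ### The fields `K∞` and `ℂ∞` -/

/-- `K∞`, the completion of `K = F(θ)` at the place at infinity. -/
abbrev KInf (F : Type*) [Field F] : Type _ :=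
  @RatFunc.CompletionAtInfty F _ (Classical.decEq _)

section Fields

variable (F : Type*) [Field F]

theorem valued_theta :
    Valued.v (algebraMap (RatFunc F) (KInf F) RatFunc.X) = WithZero.exp (1 : ℤ) := by
  classical
  have h := @Valued.valuedCompletion_apply (RatFunc F) _ ℤᵐ⁰ _
    (@RatFunc.inftyValued F _ (Classical.decEq _)) RatFunc.X
  exact h.trans (@RatFunc.inftyValuation.X F _ (Classical.decEq _))

variable [Fintype F]

theorem one_lt_card_nnreal : (1 : ℝ≥0) < (Fintype.card F : ℝ≥0) := by
  exact_mod_cast Fintype.one_lt_card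

theorem card_nnreal_ne_zero : (Fintype.card F : ℝ≥0) ≠ 0 :=
  (zero_lt_one.trans (one_lt_card_nnreal F)).ne'

open MonoidWithZeroHom.ValueGroup₀ in
/-- The valuation at infinity, made real valued so that `|θ| = q`. -/
instance rankOneKInf : (Valued.v : Valuation (KInf F) ℤᵐ⁰).RankOne where
  hom' := (WithZeroMulInt.toNNReal (card_nnreal_ne_zero F)).comp embedding
  strictMono' :=
    (WithZeroMulInt.toNNReal_strictMono (one_lt_card_nnreal F)).comp embedding_strictMono
  exists_val_nontrivial := by
    refine ⟨algebraMap (RatFunc F) (KInf F) RatFunc.X, ?_⟩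
    rw [valued_theta]
    simp [← WithZero.exp_zero]

/-- `K∞` with the absolute value normalised by `|θ| = q`. -/
instance normedFieldKInf : NormedField (KInf F) := Valued.toNormedField (KInf F) ℤᵐ⁰

theorem norm_kInf (x : KInf F) :
    ‖x‖ = WithZeroMulInt.toNNReal (card_nnreal_ne_zero F) (Valued.v x) := by
  change ((WithZeroMulInt.toNNReal (card_nnreal_ne_zero F))
    (MonoidWithZeroHom.ValueGroup₀.embedding (Valued.v.restrict x)) : ℝ) = _
  rw [Valuation.embedding_restrict]

theorem norm_theta_kInf : ‖algebraMap (RatFunc F) (KInf F) RatFunc.X‖ = Fintype.card F := by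
  rw [norm_kInf, valued_theta, WithZeroMulInt.toNNReal_neg_apply _ (by simp)]
  change (((Fintype.card F : ℝ≥0) ^ (1 : ℤ) : ℝ≥0) : ℝ) = _
  simp

instance nontriviallyNormedFieldKInf : NontriviallyNormedField (KInf F) where
  non_trivial := ⟨algebraMap (RatFunc F) (KInf F) RatFunc.X, by
    rw [norm_theta_kInf]; exact_mod_cast Fintype.one_lt_card⟩

instance isUltrametricDistKInf : IsUltrametricDist (KInf F) :=
  IsUltrametricDist.isUltrametricDist_of_forall_norm_add_le_max_norm
    (Valued.isNonarchimedean_norm (KInf F) ℤᵐ⁰)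

instance completeSpaceKInf : CompleteSpace (KInf F) :=
  @UniformSpace.Completion.completeSpace (RatFunc F)
    (@RatFunc.inftyValued F _ (Classical.decEq _)).toUniformSpace

/-- An algebraic closure of `K∞`. -/
abbrev KInfBar : Type _ := AlgebraicClosure (KInf F)

/-- The algebraic closure of `K∞`, with the unique extension of the absolute value. -/
instance normedFieldKInfBar : NormedField (KInfBar F) :=
  spectralNorm.normedField (KInf F) (KInfBar F)

instance normedAlgebraKInfBar : NormedAlgebra (KInf F) (KInfBar F) :=
  spectralNorm.normedAlgebra (KInf F) (KInfBar F)

/-- `ℂ∞`, the completion of the algebraic closure of `K∞`. -/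
abbrev CInf : Type _ := UniformSpace.Completion (KInfBar F)

/-- The embedding of `K = F(θ)` into `ℂ∞`. -/
def ofK : RatFunc F →+* CInf F :=
  (algebraMap (KInf F) (CInf F)).comp (algebraMap (RatFunc F) (KInf F))

/-- The embedding of `A = F[θ]` into `ℂ∞`. -/
def ofA : F[X] →+* CInf F := (ofK F).comp (algebraMap F[X] (RatFunc F))

/-- The element `θ` of `ℂ∞`. -/
def theta : CInf F := ofA F X

theorem norm_theta : ‖theta F‖ = Fintype.card F := by
  rw [← norm_theta_kInf F]
  simp only [theta, ofA, ofK, RingHom.comp_apply, RatFunc.algebraMap_X]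
  exact norm_algebraMap' _ _

end Fields

variable {F : Type*} [Field F] [Fintype F]

/-! ### The Frobenius `σ` and its extensions -/

variable (F) in
/-- The algebraic closure of `F_q` in `ℂ∞`. -/
def constants : Set (CInf F) :=
  {x | ((ofA F).comp (C : F →+* F[X])).IsIntegralElem x}

/-- `x = ∑_{i ≥ 0} a_i θ^(n - i)`, a Laurent series in `1/θ` with coefficients in the algebraic
closure of `F_q`. -/
def IsLaurentExpansion (n : ℤ) (a : ℕ → CInf F) (x : CInf F) : Prop :=
  (∀ i, a i ∈ constants F) ∧ HasSum (fun i : ℕ => a i * theta F ^ (n - (i : ℤ))) x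

variable (F) in
/-- The completion of the maximal unramified extension of `K∞`, that is, the set of all Laurent
series in `1/θ` with coefficients in the algebraic closure of `F_q`. -/
def unramifiedCompletion : Set (CInf F) :=
  {x | ∃ n a, IsLaurentExpansion n a x}

/-- `ψ`, an automorphism of `ℂ∞` over `K∞`, is continuous and extends
`σ (∑ a_i θ^(-i)) = ∑ a_i^q θ^(-i)`. -/
def IsExtensionOfFrobenius (ψ : CInf F ≃ₐ[KInf F] CInf F) : Prop :=
  Continuous ψ ∧ ∀ n a x, IsLaurentExpansion n a x →
    IsLaurentExpansion n (fun i => a i ^ Fintype.card F) (ψ x)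

/-! ### The Drinfeld upper half plane -/

variable (F) in
/-- `Ω = ℂ∞ \ K∞`. -/
def Omega : Set (CInf F) := (Set.range (algebraMap (KInf F) (CInf F)))ᶜ

/-- `Ω^ψ(M) = M \ M^ψ`. -/
def OmegaPsi (M : Subfield (CInf F)) (ψ : CInf F ≃ₐ[KInf F] CInf F) : Set (CInf F) :=
  {z | z ∈ M ∧ ψ z ≠ z}

theorem omegaPsi_subset (M : Subfield (CInf F)) (ψ : CInf F ≃ₐ[KInf F] CInf F) :
    OmegaPsi M ψ ⊆ Omega F := by
  rintro z ⟨-, hz⟩ ⟨x, rfl⟩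
  exact hz (ψ.commutes x)

/-- The inclusion of `Ω^ψ(M)` into `Ω`. -/
def toOmega {M : Subfield (CInf F)} {ψ : CInf F ≃ₐ[KInf F] CInf F} (z : OmegaPsi M ψ) :
    Omega F :=
  ⟨z, omegaPsi_subset M ψ z.2⟩

/-- `|z|_i = inf {|z - a| : a ∈ K∞}`. -/
def imagNorm (z : CInf F) : ℝ := Metric.infDist z (Set.range (algebraMap (KInf F) (CInf F)))

variable (F) in
/-- `Ω_n = {z ∈ Ω : |z| ≤ q^n, |z|_i ≥ q^(-n)}`. -/
def OmegaN (n : ℕ) : Set (Omega F) :=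
  {z | ‖(z : CInf F)‖ ≤ (Fintype.card F : ℝ) ^ n ∧
    ((Fintype.card F : ℝ) ^ n)⁻¹ ≤ imagNorm (z : CInf F)}

/-- `f : Ω → ℂ∞` is holomorphic: on each `Ω_n` it is a uniform limit of rational functions without
poles in `Ω_n`. -/
def IsHolomorphic (f : Omega F → CInf F) : Prop :=
  ∀ n : ℕ, 1 ≤ n → ∀ ε : ℝ, 0 < ε → ∃ P Q : (CInf F)[X], ∀ z ∈ OmegaN F n,
    Q.eval (z : CInf F) ≠ 0 ∧ ‖f z - P.eval (z : CInf F) / Q.eval (z : CInf F)‖ < ε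

/-- `f(z + ε) = ∑_n a_n ε^n` for all sufficiently small `ε ∈ ℂ∞`. -/
def HasLocalExpansion (f : Omega F → CInf F) (z : Omega F) (a : ℕ → CInf F) : Prop :=
  ∀ᶠ ε in 𝓝 (0 : CInf F), ∃ h : (z : CInf F) + ε ∈ Omega F,
    HasSum (fun n => a n * ε ^ n) (f ⟨(z : CInf F) + ε, h⟩)

open Classical in
/-- The `n`-th hyperderivative `D^n f`, the `n`-th coefficient of the local expansion of `f` at
`z`. -/
def hyperDeriv (n : ℕ) (f : Omega F → CInf F) (z : Omega F) : CInf F :=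
  if h : ∃ a, HasLocalExpansion f z a then h.choose n else 0

/-! ### The Carlitz module -/

variable (F) in
/-- The coefficients of the Carlitz exponential `exp_C(X) = ∑ e_i X^(q^i)`, given by `e_0 = 1` and
`θ^(q^i) e_i = θ e_i + e_{i-1}^q`, i.e. `exp_C(θ X) = θ exp_C(X) + exp_C(X)^q`. -/
def carlitzCoeff : ℕ → CInf F
  | 0 => 1
  | i + 1 => carlitzCoeff i ^ Fintype.card F / (theta F ^ Fintype.card F ^ (i + 1) - theta F)

theorem carlitzCoeff_functional_equation (i : ℕ) :
    theta F ^ Fintype.card F ^ (i + 1) * carlitzCoeff F (i + 1) =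
      theta F * carlitzCoeff F (i + 1) + carlitzCoeff F i ^ Fintype.card F := by
  have hq : (1 : ℝ) < Fintype.card F := by exact_mod_cast Fintype.one_lt_card
  have h : theta F ^ Fintype.card F ^ (i + 1) - theta F ≠ 0 := by
    intro h
    have h2 := congrArg norm (sub_eq_zero.mp h)
    rw [norm_pow, norm_theta] at h2
    have h3 : 1 < Fintype.card F ^ (i + 1) := Nat.one_lt_pow (by omega) Fintype.one_lt_card
    have h4 := pow_lt_pow_right₀ hq h3
    rw [h2, pow_one] at h4
    exact lt_irrefl _ h4
  rw [carlitzCoeff]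
  field_simp
  ring

/-- The Carlitz exponential `exp_C`. -/
def carlitzExp (x : CInf F) : CInf F := ∑' i : ℕ, carlitzCoeff F i * x ^ Fintype.card F ^ i

/-- `π` is the Carlitz period `θ (-θ)^(1/(q-1)) ∏_{i ≥ 1} (1 - θ^(1 - q^i))⁻¹` for some choice of the
root `(-θ)^(1/(q-1))`. -/
def IsCarlitzPeriod (π : CInf F) : Prop :=
  ∃ ϖ : CInf F, ϖ ^ (Fintype.card F - 1) = -theta F ∧
    π = theta F * ϖ *
      ∏' i : ℕ, (1 - theta F ^ (1 - (Fintype.card F : ℤ) ^ (i + 1)))⁻¹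

/-- `u_N(z) = exp_C(π z / N)⁻¹`. -/
def uParam (π : CInf F) (N : F[X]) (z : Omega F) : CInf F :=
  (carlitzExp (π * (z : CInf F) / ofA F N))⁻¹

/-! ### Congruence subgroups of `GL₂(A)` and the slash operator -/

/-- The factor `j(γ; z) = c z + d`. -/
def jFactor (γ : GL (Fin 2) F[X]) (z : CInf F) : CInf F := ofA F (γ 1 0) * z + ofA F (γ 1 1)

/-- `(a z + b) / (c z + d)`. -/
def moebius (γ : GL (Fin 2) F[X]) (z : CInf F) : CInf F :=
  (ofA F (γ 0 0) * z + ofA F (γ 0 1)) / jFactor γ z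

theorem ofA_mem_range (a : F[X]) : ofA F a ∈ (algebraMap (KInf F) (CInf F)).fieldRange :=
  ⟨algebraMap (RatFunc F) (KInf F) (algebraMap F[X] (RatFunc F) a), rfl⟩

theorem ofA_injective : Function.Injective (ofA F) :=
  (ofK F).injective.comp (IsFractionRing.injective F[X] (RatFunc F))

theorem det_ne_zero (γ : GL (Fin 2) F[X]) :
    ofA F (γ 0 0) * ofA F (γ 1 1) - ofA F (γ 0 1) * ofA F (γ 1 0) ≠ 0 := by
  have h : (γ : Matrix (Fin 2) (Fin 2) F[X]).det ≠ 0 :=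
    ((Matrix.isUnit_iff_isUnit_det _).mp γ.isUnit).ne_zero
  rw [Matrix.det_fin_two] at h
  intro h0
  apply h
  apply ofA_injective
  simpa using h0

theorem jFactor_ne_zero (γ : GL (Fin 2) F[X]) (z : Omega F) : jFactor γ (z : CInf F) ≠ 0 := by
  intro h
  have hd := det_ne_zero γ
  rw [jFactor] at h
  by_cases hc : ofA F (γ 1 0) = 0
  · rw [hc] at h hd
    simp only [zero_mul, zero_add] at h
    exact hd (by rw [h]; ring)
  · refine z.2 ?_
    have hz : (z : CInf F) = -ofA F (γ 1 1) / ofA F (γ 1 0) := by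
      rw [eq_div_iff hc]
      linear_combination h
    have := div_mem (neg_mem (ofA_mem_range (γ 1 1))) (ofA_mem_range (γ 1 0))
    rw [← hz] at this
    exact this

theorem moebius_mem (γ : GL (Fin 2) F[X]) (z : Omega F) : moebius γ (z : CInf F) ∈ Omega F := by
  rintro ⟨x, hx⟩
  have hd := det_ne_zero γ
  have hj := jFactor_ne_zero γ z
  have hxm : algebraMap (KInf F) (CInf F) x ∈ (algebraMap (KInf F) (CInf F)).fieldRange := ⟨x, rfl⟩
  rw [moebius, eq_div_iff hj, jFactor] at hx
  set y := algebraMap (KInf F) (CInf F) x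
  by_cases h : y * ofA F (γ 1 0) - ofA F (γ 0 0) = 0
  · refine hd ?_
    linear_combination (-ofA F (γ 1 1) - z * ofA F (γ 1 0)) * h + ofA F (γ 1 0) * hx
  · refine z.2 ?_
    have hz : (z : CInf F) =
        (ofA F (γ 0 1) - y * ofA F (γ 1 1)) / (y * ofA F (γ 1 0) - ofA F (γ 0 0)) := by
      rw [eq_div_iff h]
      linear_combination hx
    have := div_mem (sub_mem (ofA_mem_range (γ 0 1)) (mul_mem hxm (ofA_mem_range (γ 1 1))))
      (sub_mem (mul_mem hxm (ofA_mem_range (γ 1 0))) (ofA_mem_range (γ 0 0)))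
    rw [← hz] at this
    exact this

/-- The action of `GL₂(A)` on `Ω`. -/
def act (γ : GL (Fin 2) F[X]) (z : Omega F) : Omega F := ⟨moebius γ z, moebius_mem γ z⟩

/-- `(f|_{k,m} γ)(z) = det(γ)^m (c z + d)^(-k) f(γ z)`. The type `m` is a class modulo `q - 1`, and
`det(γ) ∈ F_q^×` has order dividing `q - 1`. -/
def slash (k : ℤ) (m : ZMod (Fintype.card F - 1)) (f : Omega F → CInf F) (γ : GL (Fin 2) F[X]) :
    Omega F → CInf F :=
  fun z => ofA F (γ : Matrix (Fin 2) (Fin 2) F[X]).det ^ m.val * jFactor γ z ^ (-k) * f (act γ z)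

/-- `Γ` contains the principal congruence subgroup `Γ(𝔫)` for some nonconstant `𝔫 ∈ A`. -/
def IsCongruence (Γ : Subgroup (GL (Fin 2) F[X])) : Prop :=
  ∃ n : F[X], 0 < n.natDegree ∧ ∀ γ : GL (Fin 2) F[X],
    n ∣ γ 0 0 - 1 → n ∣ γ 1 1 - 1 → n ∣ γ 0 1 → n ∣ γ 1 0 → γ ∈ Γ

/-- `α⁻¹ Γ α`. -/
def conjBy (Γ : Subgroup (GL (Fin 2) F[X])) (α : GL (Fin 2) F[X]) : Subgroup (GL (Fin 2) F[X]) :=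
  Γ.map (MulAut.conj α⁻¹).toMonoidHom

/-- The largest ideal `I` of `A` such that `Γ` contains all `(1 a; 0 1)` with `a ∈ I`. -/
def translationIdeal (Γ : Subgroup (GL (Fin 2) F[X])) : Ideal F[X] :=
  sSup {J | ∀ a ∈ J, Matrix.GeneralLinearGroup.upperRightHom a ∈ Γ}

set_option linter.unusedSectionVars false in
/-- The supremum that defines `translationIdeal Γ` is attained. -/
theorem translationIdeal_isGreatest (Γ : Subgroup (GL (Fin 2) F[X])) :
    IsGreatest {J : Ideal F[X] | ∀ a ∈ J, Matrix.GeneralLinearGroup.upperRightHom a ∈ Γ}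
      (translationIdeal Γ) := by
  refine ⟨fun a ha => ?_, fun J hJ => le_sSup hJ⟩
  rw [translationIdeal, sSup_eq_iSup'] at ha
  refine Submodule.iSup_induction _
    (motive := fun a => Matrix.GeneralLinearGroup.upperRightHom a ∈ Γ) ha
    (fun J x hx => J.2 x hx) ?_ fun x y hx hy => ?_
  · rw [AddChar.map_zero_eq_one]
    exact Γ.one_mem
  · rw [AddChar.map_add_eq_mul]
    exact Γ.mul_mem hx hy

/-- The monic generator `m_Γ` of `translationIdeal Γ`. -/
def mGamma (Γ : Subgroup (GL (Fin 2) F[X])) : F[X] :=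
  C (Submodule.IsPrincipal.generator (translationIdeal Γ)).leadingCoeff⁻¹ *
    Submodule.IsPrincipal.generator (translationIdeal Γ)

/-! ### Drinfeld modular forms -/

/-- `f(z) = ∑_{n ≥ 0} a_n u_{m_Γ}(z)^n` whenever `|u_{m_Γ}(z)|` is sufficiently small. As a
reciprocal, `u_{m_Γ}(z)` is nonzero. -/
def HasUExpansion (π : CInf F) (Γ : Subgroup (GL (Fin 2) F[X])) (f : Omega F → CInf F)
    (a : ℕ → CInf F) : Prop :=
  ∃ ρ : ℝ, 0 < ρ ∧ ∀ z : Omega F, uParam π (mGamma Γ) z ≠ 0 → ‖uParam π (mGamma Γ) z‖ < ρ →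
    HasSum (fun n => a n * uParam π (mGamma Γ) z ^ n) (f z)

/-- Drinfeld modular forms of weight `k` and type `m` for `Γ`. -/
structure IsDrinfeldModularForm (π : CInf F) (k : ℤ) (m : ZMod (Fintype.card F - 1))
    (Γ : Subgroup (GL (Fin 2) F[X])) (f : Omega F → CInf F) : Prop where
  holomorphic : IsHolomorphic f
  slash_eq : ∀ γ ∈ Γ, slash k m f γ = f
  holomorphic_at_infinity : ∀ α : GL (Fin 2) F[X],
    ∃ a : ℕ → CInf F, HasUExpansion π (conjBy Γ α) (slash k m f α) a

/-- `M_k^m(Γ; L)`: the `L`-vector space generated by the Drinfeld modular forms of weight `k` and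
type `m` for `Γ` whose `u_{m_Γ}`-expansion has coefficients in `L`. -/
def ModularForms (π : CInf F) (k : ℤ) (m : ZMod (Fintype.card F - 1))
    (Γ : Subgroup (GL (Fin 2) F[X])) (L : Subfield (CInf F)) :
    Submodule L (Omega F → CInf F) :=
  Submodule.span L {f | IsDrinfeldModularForm π k m Γ f ∧
    ∃ a : ℕ → CInf F, (∀ n, a n ∈ L) ∧ HasUExpansion π Γ f a}

/-! ### Maass-Shimura operators and Rankin-Cohen brackets -/

/-- The normalised hyperderivative `∂^n = π^(-n) D^n`. -/
def der (π : CInf F) (n : ℕ) (f : Omega F → CInf F) (z : Omega F) : CInf F :=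
  hyperDeriv n f z / π ^ n

/-- The Maass-Shimura operator: `δ_k^0 f = f`, and
`δ_k^r f = ∑_{i=0}^r (k+r-1 choose i) ∂^(r-i) f / (π z - π ψ(z))^i` for `r ≥ 1`. -/
def maassShimura (π : CInf F) {M : Subfield (CInf F)} {ψ : CInf F ≃ₐ[KInf F] CInf F}
    (k r : ℕ) (f : Omega F → CInf F) (z : OmegaPsi M ψ) : CInf F :=
  if r = 0 then f (toOmega z) else
    ∑ i ∈ Finset.range (r + 1), ((k + r - 1).choose i : CInf F) *
      (der π (r - i) f (toOmega z) / (π * (z : CInf F) - π * ψ (z : CInf F)) ^ i)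

/-- `(k+r-1)(k+r-2)⋯(k+ν) · (w+r-1)(w+r-2)⋯(w+r-ν)`. -/
def betaTilde (k w r ν : ℕ) : ℕ :=
  (∏ j ∈ Finset.Ico ν r, (k + j)) * ∏ j ∈ Finset.Ico (r - ν) r, (w + j)

/-- `betaTilde` divided by the greatest common divisor of its values for `0 ≤ ν ≤ r`. If all these
values vanish (which happens only for `k = w = 0`, `r = 1`), all `beta` are `0`. -/
def beta (k w r ν : ℕ) : ℕ :=
  betaTilde k w r ν / (Finset.range (r + 1)).gcd (betaTilde k w r)

/-- The Rankin-Cohen bracket `[f, g]_{k,w,r} = ∑_ν (-1)^(r-ν) β_{r,ν} (∂^ν f) (∂^(r-ν) g)`. -/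
def rankinCohen (π : CInf F) (k w r : ℕ) (f g : Omega F → CInf F) (z : Omega F) : CInf F :=
  ∑ ν ∈ Finset.range (r + 1),
    (-1) ^ (r - ν) * (beta k w r ν : CInf F) * (der π ν f z * der π (r - ν) g z)

end Drinfeld

end

/-! Both parts rest on one algebraic identity. For a parameter t, let `shift k t` send a sequence
(a_n) to the sequence b_n = ∑_i C(k+n-1, i) a_{n-i} t^i. Insert `shift k t a` and `shift w t b` into
the bracket sum. Up to a factor independent of ν, the coefficient of t^{r-i-j} a_i b_j is the
alternating sum ∑_μ (-1)^μ C(r-i-j, μ), which vanishes unless i + j = r. The bracket is therefore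
unchanged (`sum_beta_shift`).

Part (1) is this identity with t = 1/(πz - πψ(z)), since δ_k^n f is the shift of the sequence (∂^n
f)(z).

For part (2), expanding f(γ(z+x)) (cz+cx+d)^{-k} in x shows that ∂^n(f|γ) is, up to the automorphy
factor of f, the shift with t = -c/(π(cz+d)) of the sequence (det γ/(cz+d)²)^i (∂^i f)(γz)
(`der_slash`). Since t does not depend on the weight, f and g are shifted by the same t; the
identity removes the shift, and the scaling factors multiply to the r-th power that accounts for
weight 2r and type r (`rankinCohen_slash`).

Two analytic facts remain. First, D^i f is holomorphic: Taylor coefficients on Ω_n are uniform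
limits of averages, over roots of unity, of translates of f. The same averaging gives the Cauchy
estimate, and from it uniqueness of expansions and the rearrangement of double series. Second, ∂^m
preserves u-expansions over L: additivity of exp_C gives u(z+x) = u/(1 + u exp_C(πx/N)), and after
expansion in x the factor π^m cancels against the normalisation of ∂^m, leaving only constants from
K (`IsUExpandable.der`). -/

noncomputable section

set_option linter.unusedSectionVars false

namespace Drinfeld

open Polynomial Topology PowerSeries
open scoped NNReal WithZero MatrixGroups

/-! ### Power series over a complete ultrametric field -/

section PowerSeriesExpansion

variable {𝕜 : Type*} [NormedField 𝕜]

/-- `H(x) = ∑ pₙ xⁿ` for `‖x‖ < ρ`. -/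
def HasPowerSeries (ρ : ℝ) (H : 𝕜 → 𝕜) (p : 𝕜⟦X⟧) : Prop :=
  ∀ x, ‖x‖ < ρ → HasSum (fun n => PowerSeries.coeff n p * x ^ n) (H x)

/-- In a complete ultrametric setting a product of two summable families is summable, so Cauchy
products need no absolute convergence. -/
theorem hasSum_mul_antidiagonal [IsUltrametricDist 𝕜] {f g : ℕ → 𝕜} {a b : 𝕜} (hf : HasSum f a)
    (hg : HasSum g b) :
    HasSum (fun n => ∑ y ∈ Finset.HasAntidiagonal.antidiagonal n, f y.1 * g y.2) (a * b) := by
  have : NonarchimedeanRing 𝕜 := ⟨NonarchimedeanAddGroup.is_nonarchimedean⟩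
  have hs := Summable.mul_of_nonarchimedean hf.summable hg.summable
  have h3 := (summable_sum_mul_antidiagonal_of_summable_mul hs).hasSum
  rwa [← hf.summable.tsum_mul_tsum_eq_tsum_sum_antidiagonal hg.summable hs, hf.tsum_eq,
    hg.tsum_eq] at h3

namespace HasPowerSeries

variable {ρ ρ' : ℝ} {H H₁ H₂ : 𝕜 → 𝕜} {p p₁ p₂ : 𝕜⟦X⟧}

theorem mono (h : HasPowerSeries ρ H p) (hρ : ρ' ≤ ρ) : HasPowerSeries ρ' H p :=
  fun x hx => h x (hx.trans_le hρ)

theorem congr (h : HasPowerSeries ρ H₁ p) (e : ∀ x, ‖x‖ < ρ → H₂ x = H₁ x) :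
    HasPowerSeries ρ H₂ p := fun x hx => by
  rw [e x hx]; exact h x hx

theorem add (h₁ : HasPowerSeries ρ H₁ p₁) (h₂ : HasPowerSeries ρ H₂ p₂) :
    HasPowerSeries ρ (fun x => H₁ x + H₂ x) (p₁ + p₂) := fun x hx => by
  simpa [add_mul] using (h₁ x hx).add (h₂ x hx)

theorem sub (h₁ : HasPowerSeries ρ H₁ p₁) (h₂ : HasPowerSeries ρ H₂ p₂) :
    HasPowerSeries ρ (fun x => H₁ x - H₂ x) (p₁ - p₂) := fun x hx => by
  simpa [sub_mul] using (h₁ x hx).sub (h₂ x hx)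

theorem const_mul (c : 𝕜) (h : HasPowerSeries ρ H p) :
    HasPowerSeries ρ (fun x => c * H x) (PowerSeries.C c * p) := fun x hx => by
  simpa [mul_assoc] using (h x hx).mul_left c

theorem const (c : 𝕜) : HasPowerSeries ρ (fun _ => c) (PowerSeries.C c) := fun x _ => by
  have := hasSum_single (f := fun n => PowerSeries.coeff n (PowerSeries.C c) * x ^ n) 0
    (fun n hn => by simp [PowerSeries.coeff_C, hn])
  simpa using this

theorem id : HasPowerSeries ρ (fun x : 𝕜 => x) PowerSeries.X := fun x _ => by
  have := hasSum_single (f := fun n => PowerSeries.coeff n (PowerSeries.X : 𝕜⟦X⟧) * x ^ n) 1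
    (fun n hn => by simp [PowerSeries.coeff_X, hn])
  simpa using this

theorem zero_right (h : HasPowerSeries ρ H p) (hρ : 0 < ρ) : H 0 = PowerSeries.coeff 0 p := by
  have h1 := h 0 (by simpa using hρ)
  have h2 := hasSum_single (f := fun n => PowerSeries.coeff n p * (0 : 𝕜) ^ n) 0
    (fun n hn => by simp [hn])
  simpa using h1.unique h2

theorem mul_id (h : HasPowerSeries ρ H p) :
    HasPowerSeries ρ (fun x => x * H x) (PowerSeries.X * p) := fun x hx => by
  rw [← hasSum_nat_add_iff' 1]
  simpa [PowerSeries.coeff_succ_X_mul, pow_succ, mul_assoc, mul_comm, mul_left_comm] using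
    (h x hx).mul_left x

/-- Expansion of `x ↦ H (c * x)`. -/
theorem comp_mul (h : HasPowerSeries ρ H p) {c : 𝕜} (hc : ∀ x, ‖x‖ < ρ' → ‖c * x‖ < ρ) :
    HasPowerSeries ρ' (fun x => H (c * x)) (PowerSeries.rescale c p) := fun x hx => by
  simpa [mul_pow, mul_assoc, mul_comm, mul_left_comm] using h (c * x) (hc x hx)

variable [CompleteSpace 𝕜]

theorem geometric : HasPowerSeries 1 (fun x : 𝕜 => (1 - x)⁻¹) (PowerSeries.mk 1) :=
  fun x hx => by simpa using hasSum_geometric_of_norm_lt_one hx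

theorem inv_add {β : 𝕜} (hβ : β ≠ 0) :
    HasPowerSeries ‖β‖ (fun x : 𝕜 => (β + x)⁻¹)
      (PowerSeries.C β⁻¹ * PowerSeries.rescale (-β⁻¹) (PowerSeries.mk 1)) := by
  refine ((geometric.comp_mul (ρ' := ‖β‖) (c := -β⁻¹) fun x hx => ?_).const_mul β⁻¹).congr
    fun x hx => ?_
  · rw [norm_mul, norm_neg, norm_inv, inv_mul_lt_one₀ (norm_pos_iff.2 hβ)]
    exact hx
  · rw [← mul_inv]
    congr 1
    field_simp
    ring

variable [IsUltrametricDist 𝕜]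

theorem mul (h₁ : HasPowerSeries ρ H₁ p₁) (h₂ : HasPowerSeries ρ H₂ p₂) :
    HasPowerSeries ρ (fun x => H₁ x * H₂ x) (p₁ * p₂) := fun x hx => by
  convert hasSum_mul_antidiagonal (h₁ x hx) (h₂ x hx) using 1
  ext n
  rw [PowerSeries.coeff_mul, Finset.sum_mul]
  refine Finset.sum_congr rfl fun y hy => ?_
  rw [← Finset.HasAntidiagonal.mem_antidiagonal.1 hy]
  ring

theorem pow (h : HasPowerSeries ρ H p) (n : ℕ) :
    HasPowerSeries ρ (fun x => H x ^ n) (p ^ n) := by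
  induction n with
  | zero => simpa using const (ρ := ρ) (1 : 𝕜)
  | succ n ih => simpa [pow_succ] using ih.mul h

end HasPowerSeries

variable [CompleteSpace 𝕜] [IsUltrametricDist 𝕜]

theorem norm_le_of_hasSum {ι : Type*} {f : ι → 𝕜} {a : 𝕜} {B : ℝ} (h : HasSum f a) (hB : 0 ≤ B)
    (hf : ∀ i, ‖f i‖ ≤ B) : ‖a‖ ≤ B := by
  rw [← h.tsum_eq]
  exact IsUltrametricDist.norm_tsum_le_of_forall_le_of_nonneg hB hf

/-! ### Averaging over roots of unity, the Cauchy estimate, and series of power series -/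

theorem norm_eq_one_of_isPrimitiveRoot {ζ : 𝕜} {N : ℕ} (hζ : IsPrimitiveRoot ζ N) (hN : N ≠ 0) :
    ‖ζ‖ = 1 := by
  have h := congrArg norm hζ.pow_eq_one
  rw [norm_pow, norm_one] at h
  exact (pow_eq_one_iff_of_nonneg (norm_nonneg _) hN).1 h

/-- Coefficients of a power series are approximated by averages over roots of unity. -/
theorem HasPowerSeries.norm_coeff_sub_average_le {ρ : ℝ} {H : 𝕜 → 𝕜} {p : 𝕜⟦X⟧}
    (h : HasPowerSeries ρ H p) {N : ℕ} (hN : (N : 𝕜) = 1) {ζ : 𝕜} (hζ : IsPrimitiveRoot ζ N)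
    {s : 𝕜} (hs : ‖s‖ < ρ) {n : ℕ} (hn : n < N) {B : ℝ} (hB : 0 ≤ B)
    (hp : ∀ l, N ≤ l → ‖PowerSeries.coeff l p * s ^ l‖ ≤ B) :
    ‖PowerSeries.coeff n p * s ^ n -
      ∑ k ∈ Finset.range N, ((ζ ^ k)⁻¹) ^ n * H (ζ ^ k * s)‖ ≤ B := by
  have hN0 : N ≠ 0 := by omega
  have hζ1 : ‖ζ‖ = 1 := norm_eq_one_of_isPrimitiveRoot hζ hN0
  have h1 : HasSum (fun l => ∑ k ∈ Finset.range N, ((ζ ^ k)⁻¹) ^ n *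
      (PowerSeries.coeff l p * (ζ ^ k * s) ^ l))
      (∑ k ∈ Finset.range N, ((ζ ^ k)⁻¹) ^ n * H (ζ ^ k * s)) :=
    hasSum_sum fun k _ => (h _ (by simpa [hζ1] using hs)).mul_left _
  have h2 := hasSum_single (f := fun l => if l = n then PowerSeries.coeff l p * s ^ l else 0) n
    (fun l hl => by simp [hl])
  have hc : ∀ l, ∑ k ∈ Finset.range N, ((ζ ^ k)⁻¹) ^ n *
      (PowerSeries.coeff l p * (ζ ^ k * s) ^ l) =
      PowerSeries.coeff l p * s ^ l * ∑ k ∈ Finset.range N, (ζ ^ l * (ζ⁻¹) ^ n) ^ k := by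
    intro l
    rw [Finset.mul_sum]
    refine Finset.sum_congr rfl fun k _ => ?_
    simp only [mul_pow, ← pow_mul, inv_pow, mul_comm k]
    ring
  have hζ0 : ζ ≠ 0 := norm_pos_iff.1 (by rw [hζ1]; exact one_pos)
  have h3 := h2.sub h1
  simp only [if_true] at h3
  refine norm_le_of_hasSum h3 hB fun l => ?_
  rw [hc]
  rcases lt_or_ge l N with hl | hl
  · rcases eq_or_ne l n with rfl | hln
    · simp [hζ0, hN, hB]
    · have hη : ζ ^ l * ζ⁻¹ ^ n ≠ 1 := by
        rw [inv_pow, ← div_eq_mul_inv, Ne, div_eq_one_iff_eq (pow_ne_zero _ hζ0)]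
        exact fun h => hln (hζ.pow_inj hl hn h)
      have hη' : (ζ ^ l * ζ⁻¹ ^ n) ^ N = 1 := by
        rw [mul_pow, ← pow_mul, ← pow_mul, mul_comm l, mul_comm n, pow_mul, pow_mul, inv_pow ζ N,
          hζ.pow_eq_one]
        simp
      rw [geom_sum_eq hη, hη']
      simp [hln, hB]
  · rw [if_neg (by omega), zero_sub, norm_neg, norm_mul]
    refine (mul_le_of_le_one_right (norm_nonneg _) ?_).trans (hp l hl)
    refine IsUltrametricDist.norm_sum_le_of_forall_le_of_nonneg zero_le_one fun k _ => ?_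
    simp [hζ1]

/-- Taking N ≡ 1 mod p makes N prime to the characteristic, so primitive roots exist, and makes the
averaging factor 1/N equal to 1. -/
theorem exists_primitiveRoot_natCast_eq_one (p : ℕ) [Fact p.Prime] [CharP 𝕜 p] [IsAlgClosed 𝕜]
    (M : ℕ) : ∃ N, M < N ∧ (N : 𝕜) = 1 ∧ ∃ ζ : 𝕜, IsPrimitiveRoot ζ N := by
  have hN : ((p * (M + 1) + 1 : ℕ) : 𝕜) = 1 := by simp
  refine ⟨p * (M + 1) + 1, ?_, hN, ?_⟩
  · nlinarith [(Fact.out : p.Prime).pos]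
  · have : NeZero ((p * (M + 1) + 1 : ℕ) : 𝕜) := ⟨by rw [hN]; exact one_ne_zero⟩
    have := IsSepClosed.isCyclotomicExtension {p * (M + 1) + 1} 𝕜 fun a ha _ => by
      rw [Set.mem_singleton_iff.1 ha]; infer_instance
    exact IsCyclotomicExtension.exists_isPrimitiveRoot 𝕜 𝕜 (Set.mem_singleton _)
      (Nat.succ_ne_zero _)

theorem HasPowerSeries.tendsto_zero {ρ : ℝ} {H : 𝕜 → 𝕜} {p : 𝕜⟦X⟧}
    (h : HasPowerSeries ρ H p) {s : 𝕜} (hs : ‖s‖ < ρ) :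
    Filter.Tendsto (fun n => ‖PowerSeries.coeff n p * s ^ n‖) Filter.atTop (𝓝 0) :=
  tendsto_zero_iff_norm_tendsto_zero.1 (h s hs).summable.tendsto_atTop_zero

/-- The Cauchy estimate. -/
theorem HasPowerSeries.norm_coeff_le (ℓ : ℕ) [Fact ℓ.Prime] [CharP 𝕜 ℓ] [IsAlgClosed 𝕜]
    {ρ : ℝ} {H : 𝕜 → 𝕜} {p : 𝕜⟦X⟧} (h : HasPowerSeries ρ H p) {B : ℝ}
    (hB : ∀ x, ‖x‖ < ρ → ‖H x‖ ≤ B) {s : 𝕜} (hs : ‖s‖ < ρ) (n : ℕ) :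
    ‖PowerSeries.coeff n p * s ^ n‖ ≤ B := by
  have hB0 : 0 ≤ B := (norm_nonneg _).trans (hB s hs)
  -- For N large the tail of the series at s is at most δ, and the average is at most B because |ζ^k
  -- s| = |s|.
  refine le_of_forall_pos_le_add fun δ hδ => ?_
  obtain ⟨M, hM⟩ := Filter.eventually_atTop.1
    ((h.tendsto_zero hs).eventually (ge_mem_nhds hδ))
  obtain ⟨N, hN, hN1, ζ, hζ⟩ := exists_primitiveRoot_natCast_eq_one (𝕜 := 𝕜) ℓ (max M n)
  have hζ1 : ‖ζ‖ = 1 := norm_eq_one_of_isPrimitiveRoot hζ (by omega)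
  have h1 := h.norm_coeff_sub_average_le hN1 hζ hs (n := n) ((le_max_right M n).trans_lt hN) hδ.le
    fun l hl => hM l ((le_max_left M n).trans (hN.le.trans hl))
  have h2 : ‖∑ k ∈ Finset.range N, ((ζ ^ k)⁻¹) ^ n * H (ζ ^ k * s)‖ ≤ B := by
    refine IsUltrametricDist.norm_sum_le_of_forall_le_of_nonneg hB0 fun k _ => ?_
    simpa [hζ1] using hB (ζ ^ k * s) (by simpa [hζ1] using hs)
  have h3 := norm_add_le (PowerSeries.coeff n p * s ^ n -
    ∑ k ∈ Finset.range N, ((ζ ^ k)⁻¹) ^ n * H (ζ ^ k * s))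
    (∑ k ∈ Finset.range N, ((ζ ^ k)⁻¹) ^ n * H (ζ ^ k * s))
  rw [sub_add_cancel] at h3
  linarith

/-- The sum of a uniformly convergent series of power series. -/
theorem HasPowerSeries.hasSum (ℓ : ℕ) [Fact ℓ.Prime] [CharP 𝕜 ℓ] [IsAlgClosed 𝕜]
    {ρ : ℝ} {H : ℕ → 𝕜 → 𝕜} {p : ℕ → 𝕜⟦X⟧}
    (h : ∀ i, HasPowerSeries ρ (H i) (p i)) {B : ℕ → ℝ}
    (hB : ∀ i x, ‖x‖ < ρ → ‖H i x‖ ≤ B i) (hB0 : Filter.Tendsto B Filter.atTop (𝓝 0))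
    {G : 𝕜 → 𝕜} (hG : ∀ x, ‖x‖ < ρ → HasSum (fun i => H i x) (G x))
    (hρ : ∃ x : 𝕜, x ≠ 0 ∧ ‖x‖ < ρ) :
    ∃ c : 𝕜⟦X⟧, (∀ n, HasSum (fun i => PowerSeries.coeff n (p i)) (PowerSeries.coeff n c)) ∧
      HasPowerSeries ρ G c := by
  -- It suffices that the double family tends to 0 along the cofinite filter. By the Cauchy estimate
  -- all rows beyond some M are below δ, and each of the finitely many other rows tends to 0.
  have key : ∀ x, ‖x‖ < ρ → Summable fun y : ℕ × ℕ => PowerSeries.coeff y.2 (p y.1) * x ^ y.2 := by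
    intro x hx
    rw [NonarchimedeanAddGroup.summable_iff_tendsto_cofinite_zero,
      tendsto_zero_iff_norm_tendsto_zero, Metric.tendsto_nhds]
    intro δ hδ
    obtain ⟨M, hM⟩ := Filter.eventually_atTop.1 (hB0.eventually (gt_mem_nhds hδ))
    have h1 : ∀ i, ∃ K, ∀ n, K ≤ n → ‖PowerSeries.coeff n (p i) * x ^ n‖ < δ := fun i =>
      Filter.eventually_atTop.1 (((h i).tendsto_zero hx).eventually (gt_mem_nhds hδ))
    choose K hK using h1
    rw [Filter.eventually_cofinite]
    refine Set.Finite.subset (((Finset.range M).sigma fun i => Finset.range (K i)).finite_toSet.image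
      (fun y : (Σ _ : ℕ, ℕ) => (y.1, y.2))) ?_
    rintro ⟨i, n⟩ hy
    simp only [dist_zero_right, norm_norm, not_lt, Set.mem_ofPred_eq] at hy
    refine ⟨⟨i, n⟩, ?_, rfl⟩
    simp only [Finset.coe_sigma, Set.mem_sigma_iff, Finset.coe_range, Set.mem_Iio]
    constructor
    · by_contra hi
      exact absurd (((h i).norm_coeff_le ℓ (hB i) hx n).trans_lt (hM i (by omega))) (not_lt.2 hy)
    · by_contra hn
      exact absurd (hK i n (by omega)) (not_lt.2 hy)
  obtain ⟨x₀, hx₀, hxρ⟩ := hρ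
  have hcol : ∀ n, Summable fun i => PowerSeries.coeff n (p i) := by
    intro n
    have h1 := (key x₀ hxρ).comp_injective (i := fun i : ℕ => (i, n))
      (fun a b hab => (Prod.ext_iff.1 hab).1)
    exact (summable_mul_right_iff (pow_ne_zero n hx₀)).1 h1
  refine ⟨PowerSeries.mk fun n => ∑' i, PowerSeries.coeff n (p i), fun n => ?_, fun x hx => ?_⟩
  · rw [PowerSeries.coeff_mk]; exact (hcol n).hasSum
  · have h1 := (key x hx).hasSum
    have h2 := h1.prod_fiberwise fun i => h i x hx
    rw [h2.unique (hG x hx)] at h1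
    have h3 := (Equiv.prodComm ℕ ℕ).hasSum_iff.2 h1
    refine h3.prod_fiberwise fun n => ?_
    rw [PowerSeries.coeff_mk]
    exact (hcol n).hasSum.mul_right _

/-- Composition of power series. -/
theorem HasPowerSeries.comp (ℓ : ℕ) [Fact ℓ.Prime] [CharP 𝕜 ℓ] [IsAlgClosed 𝕜]
    {ρ R : ℝ} {G H : 𝕜 → 𝕜} {g p : 𝕜⟦X⟧}
    (hG : HasPowerSeries R G g) (hH : HasPowerSeries ρ H p) (hp : PowerSeries.coeff 0 p = 0)
    {y : 𝕜} (hy : ‖y‖ < R) (hb : ∀ x, ‖x‖ < ρ → ‖H x‖ ≤ ‖y‖) (hρ : ∃ x : 𝕜, x ≠ 0 ∧ ‖x‖ < ρ) :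
    HasPowerSeries ρ (fun x => G (H x)) (PowerSeries.mk fun n => ∑ i ∈ Finset.range (n + 1),
      PowerSeries.coeff i g * PowerSeries.coeff n (p ^ i)) := by
  -- Convergence of G at y bounds the terms g_i H(x)^i by |g_i y^i| → 0, uniformly in x.
  obtain ⟨c, hc, h⟩ := HasPowerSeries.hasSum ℓ (ρ := ρ)
    (H := fun i x => PowerSeries.coeff i g * H x ^ i)
    (B := fun i => ‖PowerSeries.coeff i g * y ^ i‖)
    (fun i => (hH.pow i).const_mul (PowerSeries.coeff i g))
    (fun i x hx => by
      rw [norm_mul, norm_mul, norm_pow, norm_pow]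
      gcongr
      exact hb x hx)
    (hG.tendsto_zero hy) (G := fun x => G (H x)) (fun x hx => hG _ ((hb x hx).trans_lt hy)) hρ
  convert h using 1
  ext n
  rw [PowerSeries.coeff_mk]
  refine HasSum.unique ?_ (hc n)
  simp only [PowerSeries.coeff_C_mul]
  -- Since p has no constant term, p^i has order at least i, so only i ≤ n contributes to the n-th
  -- coefficient.
  refine hasSum_sum_of_ne_finset_zero fun i hi => ?_
  rw [PowerSeries.coeff_of_lt_order n (φ := p ^ i), mul_zero]
  have h1 : (1 : ℕ∞) ≤ p.order := PowerSeries.le_order _ _ fun j hj => by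
    have : j = 0 := by simpa using hj
    rw [this, hp]
  refine lt_of_lt_of_le ?_ (PowerSeries.le_order_pow_of_constantCoeff_eq_zero _ (by simpa using hp))
  have : n < i := by simpa using hi
  exact_mod_cast this

end PowerSeriesExpansion

theorem norm_sub_le_max_norm {E : Type*} [SeminormedAddCommGroup E] [IsUltrametricDist E]
    (x y : E) : ‖x - y‖ ≤ max ‖x‖ ‖y‖ := by
  simpa [sub_eq_add_neg] using IsUltrametricDist.norm_add_le_max x (-y)

/-! ### Uniform limits of power series -/

section UniformLimit

variable {𝕜 : Type*} [NormedField 𝕜] [CompleteSpace 𝕜] [IsUltrametricDist 𝕜]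

/-- A uniform limit of power series on a disc is a power series. -/
theorem HasPowerSeries.exists_of_uniform_approx (ℓ : ℕ) [Fact ℓ.Prime] [CharP 𝕜 ℓ] [IsAlgClosed 𝕜]
    {ρ : ℝ} {H : 𝕜 → 𝕜} (hρ : ∃ x : 𝕜, x ≠ 0 ∧ ‖x‖ < ρ)
    (h : ∀ δ : ℝ, 0 < δ → ∃ (H' : 𝕜 → 𝕜) (p : 𝕜⟦X⟧), HasPowerSeries ρ H' p ∧
      ∀ x, ‖x‖ < ρ → ‖H x - H' x‖ < δ) :
    ∃ p : 𝕜⟦X⟧, HasPowerSeries ρ H p := by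
  choose G p hG hGH using fun j : ℕ => h (1 / ((j : ℝ) + 1)) (by positivity)
  have hB0 : Filter.Tendsto (fun j : ℕ => 1 / ((j : ℝ) + 1)) Filter.atTop (𝓝 0) :=
    tendsto_one_div_add_atTop_nhds_zero_nat
  have hB : ∀ (i : ℕ) x, ‖x‖ < ρ → ‖G (i + 1) x - G i x‖ ≤ 1 / ((i : ℝ) + 1) := by
    intro i x hx
    have h1 : G (i + 1) x - G i x = (H x - G i x) - (H x - G (i + 1) x) := by ring
    rw [h1]
    refine (norm_sub_le_max_norm _ _).trans (max_le (hGH i x hx).le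
      ((hGH (i + 1) x hx).le.trans ?_))
    exact one_div_le_one_div_of_le (by positivity) (by push_cast; linarith)
  -- The limit minus the first approximant is the telescoping series of the successive differences.
  obtain ⟨c, -, hc⟩ := HasPowerSeries.hasSum ℓ (H := fun i x => G (i + 1) x - G i x)
    (fun i => (hG (i + 1)).sub (hG i)) hB hB0 (G := fun x => H x - G 0 x)
    (fun x hx => by
      have h1 : Summable fun i => G (i + 1) x - G i x := by
        rw [NonarchimedeanAddGroup.summable_iff_tendsto_cofinite_zero, Nat.cofinite_eq_atTop]
        exact squeeze_zero_norm (fun i => hB i x hx) hB0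
      have h2 := h1.hasSum.tendsto_sum_nat
      have h3 : Filter.Tendsto (fun i => G i x) Filter.atTop (𝓝 (H x)) := by
        rw [tendsto_iff_norm_sub_tendsto_zero]
        refine squeeze_zero (fun _ => norm_nonneg _) (fun i => ?_) hB0
        rw [norm_sub_rev]
        exact (hGH i x hx).le
      have h4 : (fun n => ∑ i ∈ Finset.range n, (G (i + 1) x - G i x)) = fun n => G n x - G 0 x :=
        funext fun n => Finset.sum_range_sub (fun i => G i x) n
      rw [h4] at h2
      rw [← tendsto_nhds_unique h2 (h3.sub_const _)]
      exact h1.hasSum) hρ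
  exact ⟨c + p 0, (hc.add (hG 0)).congr fun x _ => by ring⟩

end UniformLimit

/-- A complete ultrametric field with an algebraically closed dense subfield is algebraically
closed. -/
theorem isAlgClosed_of_denseRange {K L : Type*} [Field K] [NontriviallyNormedField L]
    [CompleteSpace L] [IsUltrametricDist L] [Algebra K L]
    (hi : DenseRange (algebraMap K L)) [IsAlgClosed K] : IsAlgClosed L := by
  apply IsAlgClosed.of_exists_root
  intro f fmon firr
  have hd : f.natDegree ≠ 0 := (Irreducible.natDegree_pos firr).ne'
  let E := f.SplittingField
  let : NormedField E := spectralNorm.normedField L E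
  let : NormedAlgebra L E := spectralNorm.normedAlgebra L E
  let a := rootOfSplits (SplittingField.splits f) (by simpa using degree_ne_of_natDegree_ne hd)
  have fa0 : f.aeval a = 0 := by
    rw [← eval_map_algebraMap]
    exact eval_rootOfSplits (Polynomial.SplittingField.splits f)
      (by simpa using degree_ne_of_natDegree_ne hd)
  have hcl : IsClosed (Set.range (algebraMap L E)) :=
    (algebraMap_isometry L E).isClosedEmbedding.isClosed_range
  -- Continuity of roots: a root of f in its splitting field is approximated by roots of polynomials
  -- over K, which lie in K. Completeness makes L closed in the splitting field.
  have ha : a ∈ closure (Set.range (algebraMap L E)) := by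
    rw [Metric.mem_closure_iff]
    intro δ hδ
    -- This coefficient tolerance is chosen so that the bound for the distance between the roots
    -- becomes exactly δ.
    have hε : (δ / (max ‖a‖ 1)) ^ f.natDegree / (f.natDegree + 1) > 0 := by positivity
    obtain ⟨g, gmon, gdeg, gcoeff⟩ :=
      exists_monic_and_natDegree_eq_and_norm_map_algebraMap_coeff_sub_lt hi fmon hε
    obtain ⟨b, hb, hab⟩ := exists_aroots_norm_sub_lt_of_norm_coeff_sub_lt
      hε fa0 fmon (gmon.map _) (gdeg ▸ (g.natDegree_map _)) gcoeff
      (by simpa [Polynomial.map_map] using (IsAlgClosed.splits g).map ((algebraMap L E).comp _))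
    have hab : ‖a - b‖ < δ := by
      rw [← Real.rpow_natCast, ← mul_comm_div, div_self, one_mul,
        ← Real.rpow_mul (div_pos hδ (by positivity)).le, mul_inv_cancel₀] at hab
      · simpa [mul_assoc, div_mul_cancel₀ _ (by positivity : (max ‖a‖ 1) > 0).ne'] using hab
      · simp [hd]
      · positivity
    refine ⟨b, ?_, by rwa [dist_eq_norm]⟩
    rw [Polynomial.aroots_def, Splits.roots_map ((IsAlgClosed.splits g).map _),
      Multiset.mem_map] at hb
    obtain ⟨c, _, hc⟩ := hb
    exact ⟨c, hc⟩
  rw [hcl.closure_eq] at ha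
  obtain ⟨c, hc⟩ := ha
  use c
  apply_fun algebraMap L E
  · rwa [← Polynomial.aeval_algebraMap_apply_eq_algebraMap_eval, hc, map_zero]
  · exact RingHom.injective _

/-! ### The field `ℂ∞` -/

section CInfField

variable (F : Type*) [Field F] [Fintype F]

instance isUltrametricDistCInf : IsUltrametricDist (CInf F) :=
  IsUltrametricDist.of_normedAlgebra (KInf F)

instance factPrimeRingChar : Fact (ringChar F).Prime := ⟨CharP.char_is_prime F (ringChar F)⟩

instance charPCInf : CharP (CInf F) (ringChar F) :=
  charP_of_injective_ringHom ((ofA F).comp (Polynomial.C : F →+* F[X])).injective (ringChar F)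

theorem one_lt_card : (1 : ℝ) < Fintype.card F := by exact_mod_cast Fintype.one_lt_card

theorem card_pos_real : (0 : ℝ) < Fintype.card F := zero_lt_one.trans (one_lt_card F)

theorem theta_ne_zero : theta F ≠ 0 := norm_pos_iff.1 (by
  rw [norm_theta]; exact card_pos_real F)

instance isAlgClosedCInf : IsAlgClosed (CInf F) := by
  let : NontriviallyNormedField (CInf F) :=
    { (inferInstance : NormedField (CInf F)) with
      non_trivial := ⟨theta F, by rw [norm_theta]; exact one_lt_card F⟩ }
  have h : DenseRange (algebraMap (KInfBar F) (CInf F)) :=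
    UniformSpace.Completion.denseRange_coe
  exact isAlgClosed_of_denseRange h

variable {F}

theorem norm_theta_inv_pow (n : ℕ) : ‖(theta F)⁻¹ ^ n‖ = ((Fintype.card F : ℝ) ^ n)⁻¹ := by
  rw [norm_pow, norm_inv, norm_theta, inv_pow]

theorem exists_ne_zero_norm_lt {ρ : ℝ} (hρ : 0 < ρ) : ∃ x : CInf F, x ≠ 0 ∧ ‖x‖ < ρ := by
  obtain ⟨n, hn⟩ := exists_pow_lt_of_lt_one hρ (inv_lt_one_of_one_lt₀ (one_lt_card F))
  exact ⟨(theta F)⁻¹ ^ n, pow_ne_zero _ (inv_ne_zero (theta_ne_zero F)), by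
    rwa [norm_theta_inv_pow, ← inv_pow]⟩

end CInfField

variable {F : Type*} [Field F] [Fintype F]

/-! ### The affinoids `Ω_n` -/

variable (F) in
/-- `Ω_n` as a subset of `ℂ∞`. -/
def affinoid (n : ℕ) : Set (CInf F) :=
  {z | ‖z‖ ≤ (Fintype.card F : ℝ) ^ n ∧ ((Fintype.card F : ℝ) ^ n)⁻¹ ≤ imagNorm z}

theorem isClosed_range_kInf : IsClosed (Set.range (algebraMap (KInf F) (CInf F))) :=
  (algebraMap_isometry (KInf F) (CInf F)).isClosedEmbedding.isClosed_range

theorem radius_pos (F : Type*) [Field F] [Fintype F] (n : ℕ) :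
    0 < ((Fintype.card F : ℝ) ^ n)⁻¹ := inv_pos.2 (pow_pos (card_pos_real F) n)

theorem imagNorm_pos {z : CInf F} (hz : z ∈ Omega F) : 0 < imagNorm z :=
  (isClosed_range_kInf.notMem_iff_infDist_pos ⟨_, 0, rfl⟩).1 hz

theorem affinoid_subset_Omega {n : ℕ} : affinoid F n ⊆ Omega F := fun _ hz =>
  (isClosed_range_kInf.notMem_iff_infDist_pos ⟨_, 0, rfl⟩).2
    ((radius_pos F n).trans_le hz.2)

/-- A perturbation smaller than q^{-n} cannot push a distance that is at least q^{-n} below that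
bound. Hence every point of Ω_n has the same disc radius available, which is what makes all later
estimates uniform. -/
theorem add_mem_affinoid {n : ℕ} {z x : CInf F} (hz : z ∈ affinoid F n)
    (hx : ‖x‖ < ((Fintype.card F : ℝ) ^ n)⁻¹) : z + x ∈ affinoid F n := by
  have h1 : (1 : ℝ) ≤ (Fintype.card F : ℝ) ^ n := one_le_pow₀ (one_lt_card F).le
  refine ⟨(IsUltrametricDist.norm_add_le_max _ _).trans (max_le hz.1
    (hx.le.trans ((inv_le_one_of_one_le₀ h1).trans h1))), ?_⟩
  refine (Metric.le_infDist (Set.range_nonempty (algebraMap (KInf F) (CInf F)))).2 fun y hy => ?_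
  have h2 : ((Fintype.card F : ℝ) ^ n)⁻¹ ≤ ‖z - y‖ := by
    rw [← dist_eq_norm]
    exact hz.2.trans (Metric.infDist_le_dist_of_mem hy)
  have h3 : ‖z - y‖ = ‖(z + x - y) - x‖ := by congr 1; ring
  rw [h3] at h2
  rw [dist_eq_norm]
  rcases le_max_iff.1 (h2.trans (norm_sub_le_max_norm _ _)) with h | h
  · exact h
  · exact absurd hx (not_lt.2 h)

theorem exists_mem_affinoid {z : CInf F} (hz : z ∈ Omega F) : ∃ n, 1 ≤ n ∧ z ∈ affinoid F n := by
  obtain ⟨n, hn⟩ := pow_unbounded_of_one_lt (max ‖z‖ (imagNorm z)⁻¹) (one_lt_card F)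
  have h1 : (Fintype.card F : ℝ) ^ n ≤ (Fintype.card F : ℝ) ^ (n + 1) :=
    pow_le_pow_right₀ (one_lt_card F).le n.le_succ
  have h2 := hn.trans_le h1
  rw [max_lt_iff] at h2
  exact ⟨n + 1, by omega, h2.1.le, inv_le_of_inv_le₀ (imagNorm_pos hz) h2.2.le⟩

theorem isOpen_Omega : IsOpen (Omega F) := isClosed_range_kInf.isOpen_compl

/-! ### Uniform limits of rational functions -/

/-- `f` is on `Ω_n` a uniform limit of rational functions without poles in `Ω_n`. -/
def IsRationalLimit (n : ℕ) (f : CInf F → CInf F) : Prop :=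
  ∀ δ : ℝ, 0 < δ → ∃ P Q : (CInf F)[X], ∀ z ∈ affinoid F n,
    Q.eval z ≠ 0 ∧ ‖f z - P.eval z / Q.eval z‖ < δ

/-- A closer root would itself lie in Ω_n by `add_mem_affinoid`. -/
theorem norm_sub_root_ge {n : ℕ} {Q : (CInf F)[X]} (hQ : ∀ z ∈ affinoid F n, Q.eval z ≠ 0)
    {z : CInf F} (hz : z ∈ affinoid F n) {α : CInf F} (hα : α ∈ Q.roots) :
    ((Fintype.card F : ℝ) ^ n)⁻¹ ≤ ‖z - α‖ := by
  by_contra! h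
  rw [norm_sub_rev] at h
  refine hQ _ (add_mem_affinoid hz h) ?_
  rw [add_sub_cancel]
  exact (Polynomial.mem_roots'.1 hα).2

theorem eval_eq_leadingCoeff_mul_prod (Q : (CInf F)[X]) (z : CInf F) :
    Q.eval z = Q.leadingCoeff * (Q.roots.map fun α => z - α).prod := by
  conv_lhs => rw [(IsAlgClosed.splits Q).eq_prod_roots]
  simp [Polynomial.eval_multiset_prod]

theorem exists_hasPowerSeries_eval (P : (CInf F)[X]) (z : CInf F) (ρ : ℝ) :
    ∃ p, HasPowerSeries ρ (fun x => P.eval (z + x)) p := by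
  induction P using Polynomial.induction_on' with
  | add P Q hP hQ =>
    obtain ⟨p, hp⟩ := hP
    obtain ⟨q, hq⟩ := hQ
    exact ⟨_, (hp.add hq).congr fun x _ => by simp⟩
  | monomial n a =>
    exact ⟨_, ((((HasPowerSeries.const z).add HasPowerSeries.id).pow n).const_mul a).congr
      fun x _ => by simp⟩

theorem exists_hasPowerSeries_prod_inv {ρ : ℝ} (hρ : 0 < ρ) (z : CInf F) (s : Multiset (CInf F))
    (hs : ∀ α ∈ s, ρ ≤ ‖z - α‖) :
    ∃ p, HasPowerSeries ρ (fun x => ((s.map fun α => z + x - α).prod)⁻¹) p := by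
  induction s using Multiset.induction_on with
  | empty => exact ⟨_, (HasPowerSeries.const 1).congr fun x _ => by simp⟩
  | cons α s ih =>
    obtain ⟨p, hp⟩ := ih fun β hβ => hs β (Multiset.mem_cons_of_mem hβ)
    have h1 := hs α (Multiset.mem_cons_self α s)
    have h2 : z - α ≠ 0 := norm_pos_iff.1 (hρ.trans_le h1)
    exact ⟨_, (((HasPowerSeries.inv_add h2).mono h1).mul hp).congr fun x _ => by
      rw [Multiset.map_cons, Multiset.prod_cons, mul_inv, add_sub_right_comm]⟩

/-- The radius depends on n only, not on the rational function, so the expansion survives uniform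
limits. -/
theorem exists_hasPowerSeries_div {n : ℕ} {P Q : (CInf F)[X]}
    (hQ : ∀ z ∈ affinoid F n, Q.eval z ≠ 0) {z : CInf F} (hz : z ∈ affinoid F n) :
    ∃ p, HasPowerSeries ((Fintype.card F : ℝ) ^ n)⁻¹
      (fun x => P.eval (z + x) / Q.eval (z + x)) p := by
  obtain ⟨p, hp⟩ := exists_hasPowerSeries_eval P z ((Fintype.card F : ℝ) ^ n)⁻¹
  obtain ⟨q, hq⟩ := exists_hasPowerSeries_prod_inv (radius_pos F n) z Q.roots
    fun α hα => norm_sub_root_ge hQ hz hα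
  exact ⟨_, (hp.mul (hq.const_mul Q.leadingCoeff⁻¹)).congr fun x _ => by
    rw [eval_eq_leadingCoeff_mul_prod Q, div_eq_mul_inv, mul_inv]⟩

theorem exists_norm_eval_le (n : ℕ) (P : (CInf F)[X]) :
    ∃ B : ℝ, ∀ z ∈ affinoid F n, ‖P.eval z‖ ≤ B := by
  induction P using Polynomial.induction_on' with
  | add P Q hP hQ =>
    obtain ⟨p, hp⟩ := hP
    obtain ⟨q, hq⟩ := hQ
    exact ⟨p + q, fun z hz => by
      rw [Polynomial.eval_add]
      exact (norm_add_le _ _).trans (add_le_add (hp z hz) (hq z hz))⟩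
  | monomial k a =>
    refine ⟨‖a‖ * ((Fintype.card F : ℝ) ^ n) ^ k, fun z hz => ?_⟩
    rw [Polynomial.eval_monomial, norm_mul, norm_pow]
    gcongr
    exact hz.1

theorem exists_norm_prod_inv_le (n : ℕ) (s : Multiset (CInf F))
    (hs : ∀ α ∈ s, ∀ z ∈ affinoid F n, ((Fintype.card F : ℝ) ^ n)⁻¹ ≤ ‖z - α‖) :
    ∃ B : ℝ, ∀ z ∈ affinoid F n, ‖((s.map fun α => z - α).prod)⁻¹‖ ≤ B := by
  induction s using Multiset.induction_on with
  | empty => exact ⟨1, fun z _ => by simp⟩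
  | cons α s ih =>
    obtain ⟨B, hB⟩ := ih fun β hβ => hs β (Multiset.mem_cons_of_mem hβ)
    refine ⟨(Fintype.card F : ℝ) ^ n * B, fun z hz => ?_⟩
    rw [Multiset.map_cons, Multiset.prod_cons, mul_inv, norm_mul]
    gcongr
    · rw [norm_inv]
      exact inv_le_of_inv_le₀ (pow_pos (card_pos_real F) n)
        (hs α (Multiset.mem_cons_self α s) z hz)
    · exact hB z hz

/-! ### Closure properties and local expansions of uniform limits -/

namespace IsRationalLimit

variable {n : ℕ} {f g : CInf F → CInf F}

theorem congr (hf : IsRationalLimit n f) (h : ∀ z ∈ affinoid F n, g z = f z) :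
    IsRationalLimit n g := fun δ hδ => by
  obtain ⟨P, Q, hPQ⟩ := hf δ hδ
  exact ⟨P, Q, fun z hz => by rw [h z hz]; exact hPQ z hz⟩

theorem of_approx
    (h : ∀ δ : ℝ, 0 < δ → ∃ g, IsRationalLimit n g ∧ ∀ z ∈ affinoid F n, ‖f z - g z‖ ≤ δ) :
    IsRationalLimit n f := fun δ hδ => by
  obtain ⟨g, hg, hfg⟩ := h (δ / 2) (by positivity)
  obtain ⟨P, Q, hPQ⟩ := hg (δ / 2) (by positivity)
  refine ⟨P, Q, fun z hz => ⟨(hPQ z hz).1, ?_⟩⟩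
  have h1 := norm_add_le (f z - g z) (g z - P.eval z / Q.eval z)
  rw [sub_add_sub_cancel] at h1
  linarith [hfg z hz, (hPQ z hz).2]

theorem exists_norm_le (hf : IsRationalLimit n f) :
    ∃ B : ℝ, 0 < B ∧ ∀ z ∈ affinoid F n, ‖f z‖ ≤ B := by
  obtain ⟨P, Q, hPQ⟩ := hf 1 one_pos
  obtain ⟨B₁, hB₁⟩ := exists_norm_eval_le n P
  obtain ⟨B₂, hB₂⟩ := exists_norm_prod_inv_le n Q.roots fun α hα z hz =>
    norm_sub_root_ge (fun z hz => (hPQ z hz).1) hz hα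
  refine ⟨|B₁| * (‖Q.leadingCoeff⁻¹‖ * |B₂|) + 1, by positivity, fun z hz => ?_⟩
  have h1 : ‖P.eval z / Q.eval z‖ ≤ |B₁| * (‖Q.leadingCoeff⁻¹‖ * |B₂|) := by
    rw [eval_eq_leadingCoeff_mul_prod Q, div_eq_mul_inv, mul_inv, norm_mul, norm_mul]
    gcongr
    · exact (hB₁ z hz).trans (le_abs_self _)
    · exact (hB₂ z hz).trans (le_abs_self _)
  have h2 := norm_add_le (f z - P.eval z / Q.eval z) (P.eval z / Q.eval z)
  rw [sub_add_cancel] at h2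
  linarith [(hPQ z hz).2]

theorem const (c : CInf F) : IsRationalLimit n fun _ => c := fun δ hδ =>
  ⟨Polynomial.C c, 1, fun z _ => by simpa using hδ⟩

theorem add (hf : IsRationalLimit n f) (hg : IsRationalLimit n g) :
    IsRationalLimit n fun z => f z + g z := fun δ hδ => by
  obtain ⟨P₁, Q₁, h₁⟩ := hf (δ / 2) (by positivity)
  obtain ⟨P₂, Q₂, h₂⟩ := hg (δ / 2) (by positivity)
  refine ⟨P₁ * Q₂ + Q₁ * P₂, Q₁ * Q₂, fun z hz => ?_⟩
  obtain ⟨hQ₁, hb₁⟩ := h₁ z hz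
  obtain ⟨hQ₂, hb₂⟩ := h₂ z hz
  simp only [Polynomial.eval_add, Polynomial.eval_mul]
  refine ⟨mul_ne_zero hQ₁ hQ₂, ?_⟩
  rw [← div_add_div _ _ hQ₁ hQ₂, add_sub_add_comm]
  exact (norm_add_le _ _).trans_lt (by linarith)

theorem mul (hf : IsRationalLimit n f) (hg : IsRationalLimit n g) :
    IsRationalLimit n fun z => f z * g z := fun δ hδ => by
  obtain ⟨A, hA, hfA⟩ := hf.exists_norm_le
  obtain ⟨B, hB, hgB⟩ := hg.exists_norm_le
  obtain ⟨P₁, Q₁, h₁⟩ := hf (δ / (2 * (B + 1))) (by positivity)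
  -- The bound 1 keeps the second approximant below B + 1 in norm.
  obtain ⟨P₂, Q₂, h₂⟩ := hg (min 1 (δ / (2 * A))) (by positivity)
  refine ⟨P₁ * P₂, Q₁ * Q₂, fun z hz => ?_⟩
  obtain ⟨hQ₁, hb₁⟩ := h₁ z hz
  obtain ⟨hQ₂, hb₂⟩ := h₂ z hz
  rw [lt_min_iff] at hb₂
  simp only [Polynomial.eval_mul]
  refine ⟨mul_ne_zero hQ₁ hQ₂, ?_⟩
  rw [← div_mul_div_comm]
  set r₁ := P₁.eval z / Q₁.eval z
  set r₂ := P₂.eval z / Q₂.eval z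
  have h3 : f z * g z - r₁ * r₂ = f z * (g z - r₂) + (f z - r₁) * r₂ := by ring
  have h4 : ‖r₂‖ ≤ B + 1 := by
    have := norm_sub_le (g z) (g z - r₂)
    rw [sub_sub_cancel] at this
    linarith [hgB z hz]
  have h5 : ‖f z * (g z - r₂)‖ ≤ δ / 2 := by
    rw [norm_mul]
    calc ‖f z‖ * ‖g z - r₂‖ ≤ A * (δ / (2 * A)) := by
          gcongr
          · exact hfA z hz
          · exact hb₂.2.le
      _ = δ / 2 := by field_simp
  have h6 : ‖(f z - r₁) * r₂‖ < δ / 2 := by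
    rw [norm_mul]
    calc ‖f z - r₁‖ * ‖r₂‖ ≤ ‖f z - r₁‖ * (B + 1) := by gcongr
      _ < δ / (2 * (B + 1)) * (B + 1) := by gcongr
      _ = δ / 2 := by field_simp
  rw [h3]
  exact (norm_add_le _ _).trans_lt (by linarith)

theorem sum {ι : Type*} (s : Finset ι) {f : ι → CInf F → CInf F}
    (hf : ∀ i ∈ s, IsRationalLimit n (f i)) : IsRationalLimit n fun z => ∑ i ∈ s, f i z := by
  classical
  induction s using Finset.induction_on with
  | empty => simpa using const (n := n) (0 : CInf F)
  | insert a s ha ih =>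
    simp only [Finset.sum_insert ha]
    exact (hf a (Finset.mem_insert_self a s)).add
      (ih fun i hi => hf i (Finset.mem_insert_of_mem hi))

theorem comp_add (hf : IsRationalLimit n f) {c : CInf F}
    (hc : ‖c‖ < ((Fintype.card F : ℝ) ^ n)⁻¹) : IsRationalLimit n fun z => f (z + c) :=
  fun δ hδ => by
  obtain ⟨P, Q, h⟩ := hf δ hδ
  refine ⟨P.comp (Polynomial.X + Polynomial.C c), Q.comp (Polynomial.X + Polynomial.C c),
    fun z hz => ?_⟩
  simpa using h (z + c) (add_mem_affinoid hz hc)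

theorem exists_hasPowerSeries (hf : IsRationalLimit n f) {z : CInf F} (hz : z ∈ affinoid F n) :
    ∃ p, HasPowerSeries ((Fintype.card F : ℝ) ^ n)⁻¹ (fun x => f (z + x)) p := by
  refine HasPowerSeries.exists_of_uniform_approx (ringChar F)
    (exists_ne_zero_norm_lt (radius_pos F n)) fun δ hδ => ?_
  obtain ⟨P, Q, h⟩ := hf δ hδ
  obtain ⟨p, hp⟩ := exists_hasPowerSeries_div (P := P) (fun z hz => (h z hz).1) hz
  exact ⟨_, p, hp, fun x hx => (h _ (add_mem_affinoid hz hx)).2⟩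

end IsRationalLimit

/-! ### Hyperderivatives -/

open Classical in
/-- Extension of a function on `Ω` by zero to `ℂ∞`. -/
def extendZero (f : Omega F → CInf F) (z : CInf F) : CInf F :=
  if h : z ∈ Omega F then f ⟨z, h⟩ else 0

theorem extendZero_of_mem (f : Omega F → CInf F) {z : CInf F} (h : z ∈ Omega F) :
    extendZero f z = f ⟨z, h⟩ := dif_pos h

theorem isHolomorphic_iff {f : Omega F → CInf F} :
    IsHolomorphic f ↔ ∀ n, 1 ≤ n → IsRationalLimit n (extendZero f) := by
  refine forall₂_congr fun n _ => forall₂_congr fun δ _ => exists₂_congr fun P Q => ?_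
  constructor
  · intro h z hz
    rw [extendZero_of_mem f (affinoid_subset_Omega hz)]
    exact h ⟨z, affinoid_subset_Omega hz⟩ hz
  · intro h z hz
    have := h z hz
    rwa [extendZero_of_mem f z.2] at this

theorem HasLocalExpansion.exists_hasPowerSeries {f : Omega F → CInf F} {z : Omega F}
    {a : ℕ → CInf F} (h : HasLocalExpansion f z a) :
    ∃ ρ : ℝ, 0 < ρ ∧
      HasPowerSeries ρ (fun x => extendZero f ((z : CInf F) + x)) (PowerSeries.mk a) := by
  obtain ⟨ρ, hρ, hb⟩ := Metric.eventually_nhds_iff.1 h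
  refine ⟨ρ, hρ, fun x hx => ?_⟩
  obtain ⟨h1, h2⟩ := hb (y := x) (by simpa using hx)
  simpa only [PowerSeries.coeff_mk, extendZero_of_mem f h1] using h2

theorem hasLocalExpansion_of_hasPowerSeries {f : Omega F → CInf F} {z : Omega F}
    {ρ : ℝ} (hρ : 0 < ρ) {p : (CInf F)⟦X⟧}
    (h : HasPowerSeries ρ (fun x => extendZero f ((z : CInf F) + x)) p) :
    HasLocalExpansion f z fun n => PowerSeries.coeff n p := by
  have h1 : ∀ᶠ x in 𝓝 (0 : CInf F), (z : CInf F) + x ∈ Omega F := by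
    have : Filter.Tendsto (fun x : CInf F => (z : CInf F) + x) (𝓝 0) (𝓝 z) := by
      have := (continuous_const_add (z : CInf F)).tendsto 0
      rwa [add_zero] at this
    exact this.eventually (isOpen_Omega.mem_nhds z.2)
  filter_upwards [h1, Metric.ball_mem_nhds (0 : CInf F) hρ] with x hx hxρ
  refine ⟨hx, ?_⟩
  rw [← extendZero_of_mem f hx]
  exact h x (by simpa using hxρ)

/-- The Cauchy estimate with bound 0, applied to the difference; this makes the choice in
`hyperDeriv` harmless. -/
theorem HasPowerSeries.unique {ρ : ℝ} (hρ : 0 < ρ) {H : CInf F → CInf F} {p q : (CInf F)⟦X⟧}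
    (hp : HasPowerSeries ρ H p) (hq : HasPowerSeries ρ H q) : p = q := by
  obtain ⟨s, hs, hsρ⟩ := exists_ne_zero_norm_lt (F := F) hρ
  ext n
  have h1 := (hp.sub hq).norm_coeff_le (ringChar F) (B := 0) (fun x _ => by simp) hsρ n
  have h2 := norm_le_zero_iff.1 h1
  rw [mul_eq_zero, or_iff_left (pow_ne_zero n hs), map_sub, sub_eq_zero] at h2
  exact h2

theorem HasLocalExpansion.unique {f : Omega F → CInf F} {z : Omega F} {a b : ℕ → CInf F}
    (ha : HasLocalExpansion f z a) (hb : HasLocalExpansion f z b) : a = b := by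
  obtain ⟨ρ₁, h₁, hp⟩ := ha.exists_hasPowerSeries
  obtain ⟨ρ₂, h₂, hq⟩ := hb.exists_hasPowerSeries
  have h := HasPowerSeries.unique (lt_min h₁ h₂) (hp.mono (min_le_left _ _))
    (hq.mono (min_le_right _ _))
  funext n
  simpa using congrArg (PowerSeries.coeff n) h

theorem HasLocalExpansion.hyperDeriv_eq {f : Omega F → CInf F} {z : Omega F} {a : ℕ → CInf F}
    (h : HasLocalExpansion f z a) (n : ℕ) : hyperDeriv n f z = a n := by
  have hex : ∃ a, HasLocalExpansion f z a := ⟨a, h⟩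
  rw [hyperDeriv, dif_pos hex]
  exact congrFun (hex.choose_spec.unique h) n

theorem hyperDeriv_eq_coeff {f : Omega F → CInf F} {z : Omega F}
    {ρ : ℝ} (hρ : 0 < ρ) {p : (CInf F)⟦X⟧}
    (h : HasPowerSeries ρ (fun x => extendZero f ((z : CInf F) + x)) p) (n : ℕ) :
    hyperDeriv n f z = PowerSeries.coeff n p :=
  (hasLocalExpansion_of_hasPowerSeries hρ h).hyperDeriv_eq n

/-- The local expansion of a holomorphic function. -/
def taylorSeries (f : Omega F → CInf F) (z : Omega F) : (CInf F)⟦X⟧ :=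
  PowerSeries.mk fun n => hyperDeriv n f z

theorem coeff_taylorSeries (f : Omega F → CInf F) (z : Omega F) (n : ℕ) :
    PowerSeries.coeff n (taylorSeries f z) = hyperDeriv n f z := PowerSeries.coeff_mk _ _

namespace IsHolomorphic

variable {f g : Omega F → CInf F}

theorem hasPowerSeries (hf : IsHolomorphic f) {N : ℕ} (hN : 1 ≤ N) {z : Omega F}
    (hz : (z : CInf F) ∈ affinoid F N) :
    HasPowerSeries ((Fintype.card F : ℝ) ^ N)⁻¹ (fun x => extendZero f ((z : CInf F) + x))
      (taylorSeries f z) := by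
  obtain ⟨p, hp⟩ := (isHolomorphic_iff.1 hf N hN).exists_hasPowerSeries hz
  convert hp using 1
  ext n
  rw [coeff_taylorSeries, hyperDeriv_eq_coeff (radius_pos F N) hp]

theorem exists_hasPowerSeries (hf : IsHolomorphic f) (z : Omega F) : ∃ ρ : ℝ, 0 < ρ ∧
    HasPowerSeries ρ (fun x => extendZero f ((z : CInf F) + x)) (taylorSeries f z) := by
  obtain ⟨N, hN, hz⟩ := exists_mem_affinoid z.2
  exact ⟨_, radius_pos F N, hf.hasPowerSeries hN hz⟩

theorem hyperDeriv_zero (hf : IsHolomorphic f) (z : Omega F) : hyperDeriv 0 f z = f z := by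
  obtain ⟨ρ, hρ, h⟩ := hf.exists_hasPowerSeries z
  have h1 := h.zero_right hρ
  rw [coeff_taylorSeries] at h1
  rw [← h1, add_zero, extendZero_of_mem f z.2]

theorem const (c : CInf F) : IsHolomorphic fun _ : Omega F => c :=
  isHolomorphic_iff.2 fun _ _ => (IsRationalLimit.const c).congr fun _ hz =>
    extendZero_of_mem _ (affinoid_subset_Omega hz)

theorem add (hf : IsHolomorphic f) (hg : IsHolomorphic g) : IsHolomorphic fun z => f z + g z :=
  isHolomorphic_iff.2 fun n hn =>
    ((isHolomorphic_iff.1 hf n hn).add (isHolomorphic_iff.1 hg n hn)).congr fun z hz => by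
      simp only [extendZero_of_mem _ (affinoid_subset_Omega hz)]

theorem mul (hf : IsHolomorphic f) (hg : IsHolomorphic g) : IsHolomorphic fun z => f z * g z :=
  isHolomorphic_iff.2 fun n hn =>
    ((isHolomorphic_iff.1 hf n hn).mul (isHolomorphic_iff.1 hg n hn)).congr fun z hz => by
      simp only [extendZero_of_mem _ (affinoid_subset_Omega hz)]

theorem sum {ι : Type*} (s : Finset ι) {f : ι → Omega F → CInf F}
    (hf : ∀ i ∈ s, IsHolomorphic (f i)) : IsHolomorphic fun z => ∑ i ∈ s, f i z := by
  classical
  induction s using Finset.induction_on with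
  | empty => simpa using const (F := F) 0
  | insert a s ha ih =>
    simp only [Finset.sum_insert ha]
    exact (hf a (Finset.mem_insert_self a s)).add
      (ih fun i hi => hf i (Finset.mem_insert_of_mem hi))

theorem hyperDeriv_add (hf : IsHolomorphic f) (hg : IsHolomorphic g) (n : ℕ) (z : Omega F) :
    hyperDeriv n (fun z => f z + g z) z = hyperDeriv n f z + hyperDeriv n g z := by
  obtain ⟨N, hN, hz⟩ := exists_mem_affinoid z.2
  have h := (hf.hasPowerSeries hN hz).add (hg.hasPowerSeries hN hz)
  rw [hyperDeriv_eq_coeff (radius_pos F N) (h.congr fun x hx => by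
    simp only [extendZero_of_mem _ (affinoid_subset_Omega (add_mem_affinoid hz hx))]) n, map_add,
    coeff_taylorSeries, coeff_taylorSeries]

theorem hyperDeriv_const_mul (hf : IsHolomorphic f) (c : CInf F) (n : ℕ) (z : Omega F) :
    hyperDeriv n (fun z => c * f z) z = c * hyperDeriv n f z := by
  obtain ⟨N, hN, hz⟩ := exists_mem_affinoid z.2
  have h := (hf.hasPowerSeries hN hz).const_mul c
  rw [hyperDeriv_eq_coeff (radius_pos F N) (h.congr fun x hx => by
    simp only [extendZero_of_mem _ (affinoid_subset_Omega (add_mem_affinoid hz hx))]) n,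
    PowerSeries.coeff_C_mul, coeff_taylorSeries]

/-- Hyperderivatives of holomorphic functions are holomorphic. -/
theorem hyperDeriv (hf : IsHolomorphic f) (i : ℕ) : IsHolomorphic (hyperDeriv i f) := by
  refine isHolomorphic_iff.2 fun n hn => ?_
  have hfn := isHolomorphic_iff.1 hf n hn
  obtain ⟨B, hB, hfB⟩ := hfn.exists_norm_le
  have hq := one_lt_card F
  set t : CInf F := (theta F)⁻¹ with ht
  have ht0 : t ≠ 0 := inv_ne_zero (theta_ne_zero F)
  have hs' : ‖t ^ (n + 1)‖ < ((Fintype.card F : ℝ) ^ n)⁻¹ := by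
    rw [norm_theta_inv_pow]
    exact inv_strictAnti₀ (pow_pos (card_pos_real F) n) (pow_lt_pow_right₀ hq n.lt_succ_self)
  have hs : ‖t ^ (n + 2)‖ < ((Fintype.card F : ℝ) ^ n)⁻¹ := by
    rw [norm_theta_inv_pow]
    exact inv_strictAnti₀ (pow_pos (card_pos_real F) n) (pow_lt_pow_right₀ hq (by omega))
  set s := t ^ (n + 2) with hsdef
  have hs0 : s ≠ 0 := pow_ne_zero _ ht0
  -- The Cauchy estimate at the larger radius |θ|^{-(n+1)} gives geometric decay at |s| =
  -- |θ|^{-(n+2)}, uniformly in z ∈ Ω_n.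
  have hcoeff : ∀ (z : Omega F), (z : CInf F) ∈ affinoid F n → ∀ l,
      ‖PowerSeries.coeff l (taylorSeries f z) * s ^ l‖ ≤ B * (((Fintype.card F : ℝ))⁻¹) ^ l := by
    intro z hz l
    have h1 := (hf.hasPowerSeries hn hz).norm_coeff_le (ringChar F)
      (fun x hx => hfB _ (add_mem_affinoid hz hx)) hs' l
    have h2 : PowerSeries.coeff l (taylorSeries f z) * s ^ l =
        PowerSeries.coeff l (taylorSeries f z) * (t ^ (n + 1)) ^ l * t ^ l := by
      rw [hsdef, pow_succ t (n + 1), mul_pow, mul_assoc]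
    rw [h2, norm_mul, norm_theta_inv_pow, ← inv_pow]
    gcongr
  refine IsRationalLimit.of_approx fun δ hδ => ?_
  have hδ' : 0 < δ * ‖s ^ i‖ / B := by
    have := norm_pos_iff.2 (pow_ne_zero i hs0)
    positivity
  obtain ⟨M, hM⟩ := exists_pow_lt_of_lt_one hδ' (inv_lt_one_of_one_lt₀ hq)
  obtain ⟨N, hN, hN1, ζ, hζ⟩ := exists_primitiveRoot_natCast_eq_one (𝕜 := CInf F) (ringChar F)
    (max M i)
  have hMN := (le_max_left M i).trans hN.le
  have hζ1 : ‖ζ‖ = 1 := norm_eq_one_of_isPrimitiveRoot hζ (by omega)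
  -- The approximant is a finite linear combination of translates of f by elements of norm less than
  -- q^{-n}; the decay above bounds the averaging error.
  refine ⟨fun z => (s ^ i)⁻¹ * ∑ k ∈ Finset.range N, ((ζ ^ k)⁻¹) ^ i * extendZero f (z + ζ ^ k * s),
    (IsRationalLimit.const _).mul (IsRationalLimit.sum _ fun k _ =>
      (IsRationalLimit.const _).mul (hfn.comp_add (by simpa [hζ1] using hs))), fun z hz => ?_⟩
  have hzΩ := affinoid_subset_Omega hz
  rw [extendZero_of_mem _ hzΩ]
  have h1 := (hf.hasPowerSeries (z := ⟨z, hzΩ⟩) hn hz).norm_coeff_sub_average_le hN1 hζ hs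
    ((le_max_right M i).trans_lt hN) (B := δ * ‖s ^ i‖) (by positivity) fun l hl => by
      refine (hcoeff ⟨z, hzΩ⟩ hz l).trans ?_
      have h2 : ((Fintype.card F : ℝ))⁻¹ ^ l ≤ ((Fintype.card F : ℝ))⁻¹ ^ M :=
        pow_le_pow_of_le_one (inv_nonneg.2 (card_pos_real F).le)
          (inv_lt_one_of_one_lt₀ hq).le (hMN.trans hl)
      rw [mul_comm, ← le_div_iff₀ hB]
      exact h2.trans hM.le
  rw [coeff_taylorSeries] at h1
  have h3 : 0 < ‖s ^ i‖ := norm_pos_iff.2 (pow_ne_zero i hs0)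
  rw [← mul_le_mul_iff_left₀ h3, ← norm_mul, sub_mul]
  dsimp only
  rw [mul_comm (s ^ i)⁻¹, inv_mul_cancel_right₀
    (pow_ne_zero i hs0)]
  exact h1

end IsHolomorphic

/-! ### Brackets of holomorphic functions -/

theorem IsHolomorphic.der {f : Omega F → CInf F} (hf : IsHolomorphic f) (π : CInf F) (n : ℕ) :
    IsHolomorphic (der π n f) := by
  have h := (hf.hyperDeriv n).mul (IsHolomorphic.const (π ^ n)⁻¹)
  exact h

theorem IsHolomorphic.rankinCohen {f g : Omega F → CInf F} (hf : IsHolomorphic f)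
    (hg : IsHolomorphic g) (π : CInf F) (k w r : ℕ) : IsHolomorphic (rankinCohen π k w r f g) :=
  IsHolomorphic.sum _ fun _ _ => (IsHolomorphic.const _).mul ((hf.der π _).mul (hg.der π _))

/-! ### The algebraic identity behind Rankin-Cohen brackets -/

section Identity

theorem prod_Ico_add_eq_descFactorial (k i m : ℕ) :
    ∏ l ∈ Finset.Ico i (i + m), (k + l) = (k + (i + m) - 1).descFactorial m := by
  induction m with
  | zero => simp
  | succ m ih =>
    rw [← add_assoc, Finset.prod_Ico_succ_top (by omega), ih]
    -- At 0 the truncated subtraction k + (i + m) - 1 needs a separate check.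
    rcases Nat.eq_zero_or_pos (k + (i + m)) with h | h
    · obtain ⟨rfl, rfl, rfl⟩ : k = 0 ∧ i = 0 ∧ m = 0 := by omega
      simp
    · obtain ⟨N, hN⟩ : ∃ N, k + (i + m) = N + 1 := ⟨k + (i + m) - 1, by omega⟩
      have h1 : k + (i + m + 1) - 1 = N + 1 := by omega
      rw [h1, Nat.succ_descFactorial_succ, hN, Nat.add_sub_cancel, mul_comm]

theorem factorial_mul_choose_eq_prod {k i ν : ℕ} (h : i ≤ ν) :
    (ν - i).factorial * (k + ν - 1).choose (ν - i) = ∏ l ∈ Finset.Ico i ν, (k + l) := by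
  obtain ⟨m, rfl⟩ := Nat.exists_eq_add_of_le h
  rw [prod_Ico_add_eq_descFactorial, Nat.descFactorial_eq_factorial_mul_choose,
    Nat.add_sub_cancel_left]

/-- Times (ν-i)! and (r-ν-j)!, the two binomials become exactly the factors missing from the
products in `betaTilde`. The completed products do not involve ν, so ν survives only in one binomial
coefficient. -/
theorem betaTilde_mul_choose_mul_choose {k w r ν i j : ℕ} (hi : i ≤ ν) (hj : j + ν ≤ r) :
    betaTilde k w r ν * ((k + ν - 1).choose (ν - i) * (w + (r - ν) - 1).choose (r - ν - j)) *
        (r - i - j).factorial =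
      (∏ l ∈ Finset.Ico i r, (k + l)) * (∏ l ∈ Finset.Ico j r, (w + l)) *
        (r - i - j).choose (ν - i) := by
  have h1 : ν - i ≤ r - i - j := by omega
  have h2 : r - i - j - (ν - i) = r - ν - j := by omega
  rw [← Nat.choose_mul_factorial_mul_factorial h1, h2, betaTilde,
    ← Finset.prod_Ico_consecutive (fun l => k + l) hi (by omega : ν ≤ r),
    ← Finset.prod_Ico_consecutive (fun l => w + l) (by omega : j ≤ r - ν) (Nat.sub_le r ν),
    ← factorial_mul_choose_eq_prod hi, ← factorial_mul_choose_eq_prod (by omega : j ≤ r - ν)]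
  ring

theorem sum_betaTilde_eq_zero {k w r i j : ℕ} (h : i + j < r) :
    ∑ ν ∈ Finset.range (r + 1), (if i ≤ ν ∧ j + ν ≤ r then
      (-1 : ℤ) ^ (r - ν) * betaTilde k w r ν *
        ((k + ν - 1).choose (ν - i) * (w + (r - ν) - 1).choose (r - ν - j)) else 0) = 0 := by
  have hfac : ((r - i - j).factorial : ℤ) ≠ 0 := by exact_mod_cast Nat.factorial_ne_zero _
  -- The identity is proved over ℤ because this factorial may vanish in characteristic p.
  refine (mul_eq_zero.1 ?_).resolve_right hfac
  rw [Finset.sum_mul]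
  have h1 : ∀ ν ∈ Finset.range (r + 1), (if i ≤ ν ∧ j + ν ≤ r then
      (-1 : ℤ) ^ (r - ν) * betaTilde k w r ν *
        ((k + ν - 1).choose (ν - i) * (w + (r - ν) - 1).choose (r - ν - j)) else 0) *
        (r - i - j).factorial = if i ≤ ν ∧ j + ν ≤ r then
      ((∏ l ∈ Finset.Ico i r, (k + l) : ℕ) : ℤ) * (∏ l ∈ Finset.Ico j r, (w + l) : ℕ) *
        ((-1) ^ (r - ν) * (r - i - j).choose (ν - i)) else 0 := by
    intro ν _
    split_ifs with hc
    · have := congrArg (Nat.cast : ℕ → ℤ)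
        (betaTilde_mul_choose_mul_choose (k := k) (w := w) hc.1 hc.2)
      push_cast at this ⊢
      linear_combination (-1) ^ (r - ν) * this
    · simp
  rw [Finset.sum_congr rfl h1, ← Finset.sum_filter, ← Finset.mul_sum]
  have h2 : Finset.filter (fun ν => i ≤ ν ∧ j + ν ≤ r) (Finset.range (r + 1)) =
      (Finset.range (r - i - j + 1)).map (addRightEmbedding i) := by
    ext ν
    simp only [Finset.mem_filter, Finset.mem_range, Finset.mem_map, addRightEmbedding_apply]
    constructor
    · rintro ⟨-, h3, h4⟩
      exact ⟨ν - i, by omega, by omega⟩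
    · rintro ⟨μ, hμ, rfl⟩
      omega
  have h3 : ∀ μ ∈ Finset.range (r - i - j + 1), (-1 : ℤ) ^ (r - (μ + i)) *
      (r - i - j).choose (μ + i - i) = (-1) ^ (r - i) * ((-1) ^ μ * (r - i - j).choose μ) := by
    intro μ hμ
    rw [Finset.mem_range] at hμ
    have h4 : r - i = r - (μ + i) + μ := by omega
    have h5 : ((-1 : ℤ) ^ μ) * (-1) ^ μ = 1 := by rw [← mul_pow]; simp
    rw [Nat.add_sub_cancel, h4, pow_add]
    linear_combination -((-1) ^ (r - (μ + i)) * ((r - (μ + i) + μ - j).choose μ : ℤ)) * h5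
  rw [h2, Finset.sum_map]
  simp only [addRightEmbedding_apply]
  rw [Finset.sum_congr rfl h3, ← Finset.mul_sum,
    Int.alternating_sum_range_choose_of_ne (by omega : r - i - j ≠ 0), mul_zero, mul_zero]

theorem betaTilde_eq (k w r ν : ℕ) (hν : ν ∈ Finset.range (r + 1)) :
    betaTilde k w r ν = beta k w r ν * (Finset.range (r + 1)).gcd (betaTilde k w r) :=
  (Nat.div_mul_cancel (Finset.gcd_dvd hν)).symm

theorem sum_beta_eq_zero {k w r i j : ℕ} (h : i + j < r) :
    ∑ ν ∈ Finset.range (r + 1), (if i ≤ ν ∧ j + ν ≤ r then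
      (-1 : ℤ) ^ (r - ν) * beta k w r ν *
        ((k + ν - 1).choose (ν - i) * (w + (r - ν) - 1).choose (r - ν - j)) else 0) = 0 := by
  -- If the gcd is 0, natural number division makes every `beta` zero; otherwise the gcd cancels in
  -- ℤ.
  rcases eq_or_ne ((Finset.range (r + 1)).gcd (betaTilde k w r)) 0 with hg | hg
  · refine Finset.sum_eq_zero fun ν _ => ?_
    simp [beta, hg]
  · have hg' : (((Finset.range (r + 1)).gcd (betaTilde k w r) : ℕ) : ℤ) ≠ 0 := by exact_mod_cast hg
    refine (mul_eq_zero.1 ?_).resolve_right hg'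
    refine Eq.trans ?_ (sum_betaTilde_eq_zero (k := k) (w := w) h)
    rw [Finset.sum_mul]
    refine Finset.sum_congr rfl fun ν hν => ?_
    rw [betaTilde_eq k w r ν hν]
    split_ifs
    · push_cast
      ring
    · simp

/-- The coefficient of t^{r-i-j} a_i b_j in the shifted bracket. It vanishes for i + j < r by
cancellation and for i + j > r because the sum is empty; for i + j = r only ν = i remains. -/
theorem sum_beta (k w : ℕ) {r i j : ℕ} (hi : i ≤ r) :
    ∑ ν ∈ Finset.range (r + 1), (if i ≤ ν ∧ j + ν ≤ r then
      (-1 : ℤ) ^ (r - ν) * beta k w r ν *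
        ((k + ν - 1).choose (ν - i) * (w + (r - ν) - 1).choose (r - ν - j)) else 0) =
      if j = r - i then (-1) ^ (r - i) * (beta k w r i : ℤ) else 0 := by
  rcases lt_trichotomy (i + j) r with h | h | h
  · rw [sum_beta_eq_zero h, if_neg (by omega)]
  · rw [if_pos (by omega), Finset.sum_eq_single i]
    · rw [if_pos (by omega)]
      simp [show r - i - j = 0 by omega]
    · intro ν _ hν
      rw [if_neg (by omega)]
    · intro hi'
      exact absurd (Finset.mem_range.2 (by omega)) hi'
  · rw [if_neg (by omega)]
    exact Finset.sum_eq_zero fun ν _ => if_neg (by omega)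

variable {R : Type*} [CommRing R]

/-- The transform `bₙ = ∑ᵢ (k+n-1 choose i) aₙ₋ᵢ tⁱ` of sequences. -/
def shift (k : ℕ) (t : R) (a : ℕ → R) (n : ℕ) : R :=
  ∑ i ∈ Finset.range (n + 1), ((k + n - 1).choose i : R) * (a (n - i) * t ^ i)

theorem shift_zero (k : ℕ) (t : R) (a : ℕ → R) : shift k t a 0 = a 0 := by simp [shift]

/-- Reindexing by the entry of a, over a range independent of n, prepares the interchange of sums.
-/
theorem shift_eq_sum (k : ℕ) (t : R) (a : ℕ → R) {n r : ℕ} (h : n ≤ r) :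
    shift k t a n = ∑ i ∈ Finset.range (r + 1),
      if i ≤ n then ((k + n - 1).choose (n - i) : R) * (a i * t ^ (n - i)) else 0 := by
  rw [← Finset.sum_filter, shift, ← Finset.sum_range_reflect]
  refine Finset.sum_congr ?_ fun i hi => ?_
  · ext i
    simp only [Finset.mem_range, Finset.mem_filter]
    omega
  · have hi' : i ≤ n := (Finset.mem_filter.1 hi).2
    rw [show n + 1 - 1 - i = n - i by omega, show n - (n - i) = i by omega]

/-- The Rankin-Cohen sum is invariant under `shift`. -/
theorem sum_beta_shift (k w r : ℕ) (t : R) (a b : ℕ → R) :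
    ∑ ν ∈ Finset.range (r + 1),
        (-1) ^ (r - ν) * (beta k w r ν : R) * (shift k t a ν * shift w t b (r - ν)) =
      ∑ ν ∈ Finset.range (r + 1), (-1) ^ (r - ν) * (beta k w r ν : R) * (a ν * b (r - ν)) := by
  have h1 : ∀ ν ∈ Finset.range (r + 1),
      (-1) ^ (r - ν) * (beta k w r ν : R) * (shift k t a ν * shift w t b (r - ν)) =
      ∑ i ∈ Finset.range (r + 1), ∑ j ∈ Finset.range (r + 1),
        (((if i ≤ ν ∧ j + ν ≤ r then (-1 : ℤ) ^ (r - ν) * beta k w r ν *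
          ((k + ν - 1).choose (ν - i) * (w + (r - ν) - 1).choose (r - ν - j)) else 0 : ℤ) : R)) *
          (t ^ (r - i - j) * a i * b j) := by
    intro ν hν
    have hν' : ν ≤ r := Nat.lt_succ_iff.1 (Finset.mem_range.1 hν)
    rw [shift_eq_sum k t a hν', shift_eq_sum w t b (Nat.sub_le r ν), Finset.sum_mul_sum,
      Finset.mul_sum]
    refine Finset.sum_congr rfl fun i _ => ?_
    rw [Finset.mul_sum]
    refine Finset.sum_congr rfl fun j _ => ?_
    by_cases hi : i ≤ ν
    · by_cases hj : j ≤ r - ν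
      · rw [if_pos hi, if_pos hj, if_pos ⟨hi, by omega⟩,
          show r - i - j = (ν - i) + (r - ν - j) by omega]
        push_cast
        ring
      · rw [if_neg hj, if_neg (show ¬(i ≤ ν ∧ j + ν ≤ r) by omega)]
        simp
    · rw [if_neg hi, if_neg (show ¬(i ≤ ν ∧ j + ν ≤ r) by omega)]
      simp
  rw [Finset.sum_congr rfl h1, Finset.sum_comm]
  refine Finset.sum_congr rfl fun i hi => ?_
  rw [Finset.sum_comm]
  have hi' : i ≤ r := Nat.lt_succ_iff.1 (Finset.mem_range.1 hi)
  simp only [← Finset.sum_mul, ← Int.cast_sum, sum_beta k w hi']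
  rw [Finset.sum_eq_single (r - i)]
  · rw [if_pos rfl, show r - i - (r - i) = 0 by omega]
    push_cast
    ring
  · intro j _ hj
    rw [if_neg hj]
    simp
  · intro h
    exact absurd (Finset.mem_range.2 (by omega)) h

end Identity

/-- The case r = 0, separate in the definition, agrees with the shift because D^0 f = f for
holomorphic f. -/
theorem maassShimura_eq_shift {π : CInf F} {M : Subfield (CInf F)}
    {ψ : CInf F ≃ₐ[KInf F] CInf F} (k r : ℕ) {f : Omega F → CInf F} (hf : IsHolomorphic f)
    (z : OmegaPsi M ψ) :
    maassShimura π k r f z = shift k (π * (z : CInf F) - π * ψ (z : CInf F))⁻¹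
      (fun n => der π n f (toOmega z)) r := by
  rw [maassShimura]
  split_ifs with hr
  · rw [hr, shift_zero, der, hf.hyperDeriv_zero, pow_zero, div_one]
  · simp only [shift, inv_pow, div_eq_mul_inv]

theorem rankinCohen_eq_sum_maassShimura {π : CInf F} {M : Subfield (CInf F)}
    {ψ : CInf F ≃ₐ[KInf F] CInf F} (k w r : ℕ) {f g : Omega F → CInf F} (hf : IsHolomorphic f)
    (hg : IsHolomorphic g) (z : OmegaPsi M ψ) :
    rankinCohen π k w r f g (toOmega z) =
      ∑ ν ∈ Finset.range (r + 1), (-1) ^ (r - ν) * (beta k w r ν : CInf F) *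
        (maassShimura π k ν f z * maassShimura π w (r - ν) g z) := by
  simp only [maassShimura_eq_shift _ _ hf, maassShimura_eq_shift _ _ hg]
  rw [sum_beta_shift]
  rfl

/-! ### Composition of expansions -/

/-- The power series `∑ᵢ gᵢ pⁱ`, for `p` without constant term. -/
def compSeries {R : Type*} [CommRing R] (g p : R⟦X⟧) : R⟦X⟧ :=
  PowerSeries.mk fun n => ∑ i ∈ Finset.range (n + 1),
    PowerSeries.coeff i g * PowerSeries.coeff n (p ^ i)

theorem coeff_pow_eq_zero {R : Type*} [CommRing R] {p : R⟦X⟧} (hp : PowerSeries.coeff 0 p = 0)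
    {n i : ℕ} (h : n < i) : PowerSeries.coeff n (p ^ i) = 0 := by
  refine PowerSeries.coeff_of_lt_order _ (lt_of_lt_of_le ?_
    (PowerSeries.le_order_pow_of_constantCoeff_eq_zero _ (by simpa using hp)))
  exact_mod_cast h

theorem coeff_mul_compSeries {R : Type*} [CommRing R] (g : R⟦X⟧) {p : R⟦X⟧} (q : R⟦X⟧)
    (hp : PowerSeries.coeff 0 p = 0) (n : ℕ) :
    PowerSeries.coeff n (q * compSeries g p) =
      ∑ i ∈ Finset.range (n + 1), PowerSeries.coeff i g * PowerSeries.coeff n (q * p ^ i) := by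
  have h1 : ∀ b, b ≤ n → PowerSeries.coeff b (compSeries g p) =
      ∑ i ∈ Finset.range (n + 1), PowerSeries.coeff i g * PowerSeries.coeff b (p ^ i) := by
    intro b hb
    rw [compSeries, PowerSeries.coeff_mk]
    refine Finset.sum_subset (Finset.range_mono (by omega)) fun i _ hi => ?_
    rw [coeff_pow_eq_zero hp (by simpa using hi), mul_zero]
  simp only [PowerSeries.coeff_mul, Finset.mul_sum]
  rw [Finset.sum_comm]
  refine Finset.sum_congr rfl fun y hy => ?_
  have hy' := Finset.HasAntidiagonal.mem_antidiagonal.1 hy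
  rw [h1 y.2 (by omega), Finset.mul_sum]
  exact Finset.sum_congr rfl fun i _ => by ring

/-- A convergent power series without constant term is small near `0`. -/
theorem HasPowerSeries.exists_norm_le {ρ : ℝ} (hρ : 0 < ρ) {H : CInf F → CInf F}
    {p : (CInf F)⟦X⟧} (h : HasPowerSeries ρ H p) (hp : PowerSeries.coeff 0 p = 0) {δ : ℝ}
    (hδ : 0 < δ) : ∃ ρ' : ℝ, 0 < ρ' ∧ ρ' ≤ ρ ∧ ∀ x, ‖x‖ < ρ' → ‖H x‖ ≤ δ := by
  obtain ⟨s, hs, hsρ⟩ := exists_ne_zero_norm_lt (F := F) hρ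
  obtain ⟨B, hB⟩ := (h.tendsto_zero hsρ).bddAbove_range
  have hB' : ∀ n, ‖PowerSeries.coeff n p * s ^ n‖ ≤ |B| + 1 := fun n =>
    (hB ⟨n, rfl⟩).trans ((le_abs_self B).trans (by linarith))
  have hs0 : 0 < ‖s‖ := norm_pos_iff.2 hs
  have hB0 : 0 < |B| + 1 := by positivity
  -- The coefficients are bounded by |B| + 1 at s, and each term of positive degree gains at least
  -- one factor |x/s| ≤ δ/(|B| + 1).
  refine ⟨min ‖s‖ (‖s‖ * δ / (|B| + 1)), by positivity, (min_le_left _ _).trans hsρ.le,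
    fun x hx => ?_⟩
  rw [lt_min_iff] at hx
  refine norm_le_of_hasSum (h x (hx.1.trans hsρ)) hδ.le fun n => ?_
  rcases Nat.eq_zero_or_pos n with rfl | hn
  · simpa [hp] using hδ.le
  · have h1 : PowerSeries.coeff n p * x ^ n = PowerSeries.coeff n p * s ^ n * (x / s) ^ n := by
      rw [mul_assoc, ← mul_pow, show s * (x / s) = x by field_simp]
    have h2 : ‖x / s‖ ≤ δ / (|B| + 1) := by
      rw [norm_div, div_le_div_iff₀ hs0 hB0]
      have := hx.2.le
      rw [le_div_iff₀ hB0] at this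
      linarith
    have h3 : ‖x / s‖ ≤ 1 := by
      rw [norm_div, div_le_one hs0]
      exact hx.1.le
    rw [h1, norm_mul, norm_pow]
    calc _ ≤ (|B| + 1) * ‖x / s‖ := by
          gcongr
          · exact hB' n
          · exact pow_le_of_le_one (norm_nonneg _) h3 (by omega)
      _ ≤ (|B| + 1) * (δ / (|B| + 1)) := by gcongr
      _ = δ := by field_simp

theorem HasPowerSeries.exists_comp {ρ R : ℝ} (hρ : 0 < ρ) (hR : 0 < R) {G H : CInf F → CInf F}
    {g p : (CInf F)⟦X⟧} (hG : HasPowerSeries R G g) (hH : HasPowerSeries ρ H p)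
    (hp : PowerSeries.coeff 0 p = 0) :
    ∃ ρ' : ℝ, 0 < ρ' ∧ ρ' ≤ ρ ∧ (∀ x, ‖x‖ < ρ' → ‖H x‖ < R) ∧
      HasPowerSeries ρ' (fun x => G (H x)) (compSeries g p) := by
  obtain ⟨y, hy, hyR⟩ := exists_ne_zero_norm_lt (F := F) hR
  obtain ⟨ρ', h1, h2, h3⟩ := hH.exists_norm_le hρ hp (norm_pos_iff.2 hy)
  exact ⟨ρ', h1, h2, fun x hx => (h3 x hx).trans_lt hyR,
    HasPowerSeries.comp (ringChar F) hG (hH.mono h2) hp hyR h3 (exists_ne_zero_norm_lt h1)⟩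

/-- The series `∑ tⁿ Xⁿ`. -/
def geomSeries {R : Type*} [CommRing R] (t : R) : R⟦X⟧ :=
  PowerSeries.rescale t (PowerSeries.mk 1)

/-- The negative binomial series. With truncated subtraction it also holds for m = 0, as C(l-1, l) =
0 for l > 0. -/
theorem coeff_geomSeries_pow {R : Type*} [CommRing R] (t : R) (m l : ℕ) :
    PowerSeries.coeff l (geomSeries t ^ m) = ((m + l - 1).choose l : R) * t ^ l := by
  rw [geomSeries, ← map_pow, PowerSeries.coeff_rescale, mul_comm]
  congr 1
  rcases m with _ | d
  · rcases l with _ | l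
    · simp
    · simp [PowerSeries.coeff_one]
  · rw [PowerSeries.mk_one_pow_eq_mk_choose_add, PowerSeries.coeff_mk,
      show d + 1 + l - 1 = d + l by omega, Nat.choose_symm_add]

theorem hasPowerSeries_inv_linear {j : CInf F} (hj : j ≠ 0) (c : CInf F) :
    ∃ ρ : ℝ, 0 < ρ ∧ HasPowerSeries ρ (fun x => (j + c * x)⁻¹)
      (PowerSeries.C j⁻¹ * geomSeries (-c / j)) := by
  have hd : 0 < ‖-c / j‖ + 1 := by positivity
  refine ⟨(‖-c / j‖ + 1)⁻¹, inv_pos.2 hd,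
    ((HasPowerSeries.geometric.comp_mul (c := -c / j) fun x hx => ?_).const_mul j⁻¹).congr
    fun x hx => ?_⟩
  · rw [norm_mul]
    calc ‖-c / j‖ * ‖x‖ ≤ ‖-c / j‖ * (‖-c / j‖ + 1)⁻¹ := by gcongr
      _ < (‖-c / j‖ + 1) * (‖-c / j‖ + 1)⁻¹ := by gcongr; linarith
      _ = 1 := mul_inv_cancel₀ hd.ne'
  · rw [← mul_inv]
    congr 1
    field_simp
    ring

/-! ### Brackets and the slash operator -/

/-- γ(z+x) - γz = x det γ/(j(z) j(z+x)), written with the factor x in front so that its expansion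
visibly has no constant term and can be substituted into the expansion of f at γz. -/
theorem moebius_add (γ : GL (Fin 2) F[X]) (z : CInf F) {x : CInf F} (hz : jFactor γ z ≠ 0)
    (hx : jFactor γ (z + x) ≠ 0) :
    moebius γ (z + x) = moebius γ z + x * (ofA F (γ : Matrix (Fin 2) (Fin 2) F[X]).det *
      (jFactor γ z)⁻¹ * (jFactor γ z + ofA F (γ 1 0) * x)⁻¹) := by
  have h : jFactor γ (z + x) = jFactor γ z + ofA F (γ 1 0) * x := by
    simp only [jFactor]
    ring
  rw [h] at hx
  have h1 : x * (ofA F (γ : Matrix (Fin 2) (Fin 2) F[X]).det * (jFactor γ z)⁻¹ *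
      (jFactor γ z + ofA F (γ 1 0) * x)⁻¹) = x * ofA F (γ : Matrix (Fin 2) (Fin 2) F[X]).det /
        (jFactor γ z * (jFactor γ z + ofA F (γ 1 0) * x)) := by
    rw [div_eq_mul_inv, mul_inv]
    ring
  rw [h1, moebius, moebius, h, div_add_div _ _ hz (mul_ne_zero hz hx),
    div_eq_div_iff hx (mul_ne_zero hz (mul_ne_zero hz hx)), Matrix.det_fin_two]
  simp only [jFactor, map_sub, map_mul]
  ring

/-- Local expansion of `f|γ`. -/
theorem hyperDeriv_slash {f : Omega F → CInf F} (hf : IsHolomorphic f) (k : ℕ)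
    (m : ZMod (Fintype.card F - 1)) (γ : GL (Fin 2) F[X]) (z : Omega F) (n : ℕ) :
    hyperDeriv n (slash k m f γ) z =
      ofA F (γ : Matrix (Fin 2) (Fin 2) F[X]).det ^ m.val * (jFactor γ (z : CInf F))⁻¹ ^ k *
        shift k (-ofA F (γ 1 0) / jFactor γ (z : CInf F)) (fun i =>
          (ofA F (γ : Matrix (Fin 2) (Fin 2) F[X]).det * (jFactor γ (z : CInf F))⁻¹ ^ 2) ^ i *
            hyperDeriv i f (act γ z)) n := by
  have hj := jFactor_ne_zero γ z
  set j := jFactor γ (z : CInf F) with hjdef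
  set c := ofA F (γ 1 0)
  set D := ofA F (γ : Matrix (Fin 2) (Fin 2) F[X]).det with hD
  obtain ⟨ρ₁, hρ₁, hJ⟩ := hasPowerSeries_inv_linear hj c
  have hH := (hJ.const_mul (D * j⁻¹)).mul_id
  obtain ⟨R, hR, hG⟩ := hf.exists_hasPowerSeries (act γ z)
  obtain ⟨ρ₂, hρ₂, h₂₁, -, hcomp⟩ := HasPowerSeries.exists_comp hρ₁ hR hG hH
    (PowerSeries.coeff_zero_X_mul _)
  obtain ⟨N, hN, hzN⟩ := exists_mem_affinoid z.2
  have hρ : 0 < min ρ₂ ((Fintype.card F : ℝ) ^ N)⁻¹ := lt_min hρ₂ (radius_pos F N)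
  have hq := ((hJ.mono h₂₁).pow k).const_mul (D ^ m.val)
  have key := (hq.mul hcomp).mono (min_le_left ρ₂ ((Fintype.card F : ℝ) ^ N)⁻¹)
  rw [hyperDeriv_eq_coeff hρ (key.congr fun x hx => ?_) n,
    coeff_mul_compSeries _ _ (PowerSeries.coeff_zero_X_mul _), shift_eq_sum _ _ _ le_rfl,
    Finset.mul_sum]
  · refine Finset.sum_congr rfl fun i hi => ?_
    have hi' : i ≤ n := Nat.lt_succ_iff.1 (Finset.mem_range.1 hi)
    -- The i-th power of the inner series adds i to the exponent k of the geometric series; the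
    -- coefficient of X^n is then the binomial C(k+n-1, n-i) of `shift`.
    have h1 : (PowerSeries.C (D ^ m.val) * (PowerSeries.C j⁻¹ * geomSeries (-c / j)) ^ k *
        (PowerSeries.X * (PowerSeries.C (D * j⁻¹) *
          (PowerSeries.C j⁻¹ * geomSeries (-c / j)))) ^ i) =
        PowerSeries.C (D ^ m.val * j⁻¹ ^ k * (D * j⁻¹ ^ 2) ^ i) *
          (PowerSeries.X ^ i * geomSeries (-c / j) ^ (k + i)) := by
      simp only [map_mul, map_pow]
      ring
    obtain ⟨l, rfl⟩ := Nat.exists_eq_add_of_le' hi'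
    rw [if_pos hi', coeff_taylorSeries, h1, PowerSeries.coeff_C_mul,
      PowerSeries.coeff_X_pow_mul, coeff_geomSeries_pow, Nat.add_sub_cancel,
      show k + i + l - 1 = k + (l + i) - 1 by omega]
    ring
  · rw [lt_min_iff] at hx
    have hΩ := affinoid_subset_Omega (add_mem_affinoid hzN hx.2)
    have hjx := jFactor_ne_zero γ ⟨_, hΩ⟩
    have hjx' : jFactor γ ((z : CInf F) + x) = j + c * x := by
      rw [hjdef, jFactor, jFactor]
      ring
    have hm := moebius_add γ (z : CInf F) hj hjx
    rw [extendZero_of_mem _ hΩ, slash]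
    have h3 : extendZero f ((act γ z : Omega F) + x * (D * j⁻¹ * (j + c * x)⁻¹)) =
        f (act γ ⟨_, hΩ⟩) := by
      rw [← extendZero_of_mem f (act γ ⟨_, hΩ⟩).2]
      exact congrArg (extendZero f) hm.symm
    rw [h3]
    dsimp only
    rw [hjx', zpow_neg, zpow_natCast, inv_pow]

theorem der_slash (π : CInf F) {f : Omega F → CInf F} (hf : IsHolomorphic f) (k : ℕ)
    (m : ZMod (Fintype.card F - 1)) (γ : GL (Fin 2) F[X]) (z : Omega F) (n : ℕ) :
    der π n (slash k m f γ) z =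
      ofA F (γ : Matrix (Fin 2) (Fin 2) F[X]).det ^ m.val * (jFactor γ (z : CInf F))⁻¹ ^ k *
        shift k (-ofA F (γ 1 0) / jFactor γ (z : CInf F) / π) (fun i =>
          (ofA F (γ : Matrix (Fin 2) (Fin 2) F[X]).det * (jFactor γ (z : CInf F))⁻¹ ^ 2) ^ i *
            der π i f (act γ z)) n := by
  rw [der, hyperDeriv_slash hf, mul_div_assoc]
  congr 1
  rw [shift, shift, Finset.sum_div]
  refine Finset.sum_congr rfl fun i hi => ?_
  have hi' : i ≤ n := Nat.lt_succ_iff.1 (Finset.mem_range.1 hi)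
  have h1 : (π ^ n)⁻¹ = (π ^ (n - i))⁻¹ * (π ^ i)⁻¹ := by
    rw [← mul_inv, ← pow_add, Nat.sub_add_cancel hi']
  rw [der, div_eq_mul_inv, h1, div_pow _ π, div_eq_mul_inv _ (π ^ i),
    div_eq_mul_inv _ (π ^ (n - i))]
  ring

theorem det_pow_card_sub_one (γ : GL (Fin 2) F[X]) :
    ofA F (γ : Matrix (Fin 2) (Fin 2) F[X]).det ^ (Fintype.card F - 1) = 1 := by
  obtain ⟨u, hu, h⟩ := Polynomial.isUnit_iff.1 ((Matrix.isUnit_iff_isUnit_det _).1 γ.isUnit)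
  rw [← h, ← map_pow, ← map_pow, FiniteField.pow_card_sub_one_eq_one u hu.ne_zero, map_one, map_one]

/-- The determinant is a unit of F[θ], hence in F_q^×, so its powers depend on the exponent modulo q
- 1 only. -/
theorem det_pow_eq (γ : GL (Fin 2) F[X]) (m₁ m₂ : ZMod (Fintype.card F - 1)) (r : ℕ) :
    ofA F (γ : Matrix (Fin 2) (Fin 2) F[X]).det ^ (m₁ + m₂ + (r : ZMod (Fintype.card F - 1))).val =
      ofA F (γ : Matrix (Fin 2) (Fin 2) F[X]).det ^ (m₁.val + m₂.val + r) := by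
  have : NeZero (Fintype.card F - 1) := ⟨by have := Fintype.one_lt_card (α := F); omega⟩
  have h : m₁ + m₂ + (r : ZMod (Fintype.card F - 1)) =
      ((m₁.val + m₂.val + r : ℕ) : ZMod (Fintype.card F - 1)) := by
    push_cast
    rw [ZMod.natCast_zmod_val, ZMod.natCast_zmod_val]
  rw [h, ZMod.val_natCast]
  exact (pow_eq_pow_mod _ (det_pow_card_sub_one γ)).symm

/-- Rankin-Cohen brackets commute with the slash operators. -/
theorem rankinCohen_slash (π : CInf F) {f g : Omega F → CInf F} (hf : IsHolomorphic f)
    (hg : IsHolomorphic g) (k w r : ℕ) (m₁ m₂ : ZMod (Fintype.card F - 1))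
    (γ : GL (Fin 2) F[X]) :
    rankinCohen π k w r (slash k m₁ f γ) (slash w m₂ g γ) =
      slash (k + w + 2 * r) (m₁ + m₂ + (r : ZMod (Fintype.card F - 1)))
        (rankinCohen π k w r f g) γ := by
  funext z
  rw [rankinCohen, slash]
  simp only [der_slash π hf, der_slash π hg]
  set j := jFactor γ (z : CInf F)
  set D := ofA F (γ : Matrix (Fin 2) (Fin 2) F[X]).det
  -- The same t serves f and g, as it does not involve the weights.
  set t := -ofA F (γ 1 0) / j / π
  have h1 := sum_beta_shift k w r t (fun i => (D * j⁻¹ ^ 2) ^ i * der π i f (act γ z))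
    (fun i => (D * j⁻¹ ^ 2) ^ i * der π i g (act γ z))
  have h2 : ∀ ν ∈ Finset.range (r + 1), (-1) ^ (r - ν) * (beta k w r ν : CInf F) *
      ((D * j⁻¹ ^ 2) ^ ν * der π ν f (act γ z) *
        ((D * j⁻¹ ^ 2) ^ (r - ν) * der π (r - ν) g (act γ z))) = (D * j⁻¹ ^ 2) ^ r *
      ((-1) ^ (r - ν) * (beta k w r ν : CInf F) *
        (der π ν f (act γ z) * der π (r - ν) g (act γ z))) := by
    intro ν hν
    have hν' : ν ≤ r := Nat.lt_succ_iff.1 (Finset.mem_range.1 hν)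
    have h3 : (D * j⁻¹ ^ 2) ^ r = (D * j⁻¹ ^ 2) ^ ν * (D * j⁻¹ ^ 2) ^ (r - ν) := by
      rw [← pow_add, Nat.add_sub_cancel' hν']
    rw [h3]
    ring
  rw [Finset.sum_congr rfl h2, ← Finset.mul_sum] at h1
  have h4 : j ^ (-((k : ℤ) + w + 2 * r)) = j⁻¹ ^ (k + w + 2 * r) := by
    rw [inv_pow, ← zpow_natCast, ← zpow_neg]
    push_cast
    rfl
  rw [h4, det_pow_eq, rankinCohen]
  calc _ = D ^ m₁.val * j⁻¹ ^ k * (D ^ m₂.val * j⁻¹ ^ w) * ∑ ν ∈ Finset.range (r + 1),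
        (-1) ^ (r - ν) * (beta k w r ν : CInf F) *
        (shift k t (fun i => (D * j⁻¹ ^ 2) ^ i * der π i f (act γ z)) ν *
          shift w t (fun i => (D * j⁻¹ ^ 2) ^ i * der π i g (act γ z)) (r - ν)) := by
        rw [Finset.mul_sum]
        exact Finset.sum_congr rfl fun ν _ => by ring
    _ = _ := by
        rw [h1]
        ring

/-! ### The Carlitz exponential -/

/-- |e_i| = q^{-i q^i}, since |θ^{q^i} - θ| = q^{q^i} for i ≥ 1; hence exp_C converges everywhere.
-/
theorem norm_carlitzCoeff (i : ℕ) :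
    ‖carlitzCoeff F i‖ = (((Fintype.card F : ℝ) ^ i)⁻¹) ^ Fintype.card F ^ i := by
  induction i with
  | zero => simp [carlitzCoeff]
  | succ i ih =>
    have hq := one_lt_card F
    have h1 : 1 < Fintype.card F ^ (i + 1) := Nat.one_lt_pow (by omega) Fintype.one_lt_card
    have h2 : ‖theta F‖ < ‖theta F ^ Fintype.card F ^ (i + 1)‖ := by
      rw [norm_pow, norm_theta]
      simpa using pow_lt_pow_right₀ hq h1
    have h3 : ‖theta F ^ Fintype.card F ^ (i + 1) - theta F‖ =
        (Fintype.card F : ℝ) ^ Fintype.card F ^ (i + 1) := by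
      rw [sub_eq_add_neg, IsUltrametricDist.norm_add_eq_max_of_norm_ne_norm
        (by rw [norm_neg]; exact h2.ne'), norm_neg, max_eq_left h2.le, norm_pow, norm_theta]
    rw [carlitzCoeff, norm_div, norm_pow, ih, h3, ← pow_mul, ← pow_succ, div_eq_mul_inv,
      inv_pow, inv_pow, ← mul_inv, ← mul_pow, ← pow_succ]

theorem summable_carlitzExp (x : CInf F) :
    Summable fun i : ℕ => carlitzCoeff F i * x ^ Fintype.card F ^ i := by
  have hq := one_lt_card F
  have hx : Filter.Tendsto (fun i : ℕ => ‖x‖ * ((Fintype.card F : ℝ)⁻¹) ^ i) Filter.atTop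
      (𝓝 0) := by
    simpa using (tendsto_pow_atTop_nhds_zero_of_lt_one (inv_nonneg.2 (card_pos_real F).le)
      (inv_lt_one_of_one_lt₀ hq)).const_mul ‖x‖
  rw [NonarchimedeanAddGroup.summable_iff_tendsto_cofinite_zero, Nat.cofinite_eq_atTop]
  refine squeeze_zero_norm' ?_ hx
  filter_upwards [hx.eventually (gt_mem_nhds one_pos)] with i hi
  rw [norm_mul, norm_carlitzCoeff, norm_pow, ← mul_pow, mul_comm, ← inv_pow]
  exact pow_le_of_le_one (by positivity) hi.le (pow_pos Fintype.card_pos i).ne'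

theorem add_pow_card_pow (x y : CInf F) (i : ℕ) :
    (x + y) ^ Fintype.card F ^ i = x ^ Fintype.card F ^ i + y ^ Fintype.card F ^ i := by
  obtain ⟨n, -, hn⟩ := FiniteField.card F (ringChar F)
  rw [hn, ← pow_mul]
  exact add_pow_char_pow x y _ _

theorem carlitzExp_add (x y : CInf F) : carlitzExp (x + y) = carlitzExp x + carlitzExp y := by
  have h := (summable_carlitzExp x).hasSum.add (summable_carlitzExp y).hasSum
  refine Eq.trans ?_ h.tsum_eq
  simp only [carlitzExp, add_pow_card_pow, mul_add]

variable (F) in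
/-- The Carlitz exponential as a power series. -/
def carlitzSeries : (CInf F)⟦X⟧ :=
  PowerSeries.mk (Function.extend (fun i => Fintype.card F ^ i) (carlitzCoeff F) 0)

theorem injective_card_pow : Function.Injective fun i : ℕ => Fintype.card F ^ i :=
  Nat.pow_right_injective Fintype.one_lt_card

theorem hasPowerSeries_carlitzExp (ρ : ℝ) :
    HasPowerSeries ρ (carlitzExp : CInf F → CInf F) (carlitzSeries F) := fun x _ => by
  have h : (fun n => PowerSeries.coeff n (carlitzSeries F) * x ^ n) =
      Function.extend (fun i => Fintype.card F ^ i)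
        (fun i => carlitzCoeff F i * x ^ Fintype.card F ^ i) 0 := by
    funext n
    rw [carlitzSeries, PowerSeries.coeff_mk]
    by_cases hn : ∃ i, Fintype.card F ^ i = n
    · obtain ⟨i, rfl⟩ := hn
      rw [injective_card_pow.extend_apply, injective_card_pow.extend_apply]
    · rw [Function.extend_apply' _ _ _ hn, Function.extend_apply' _ _ _ hn]
      simp
  rw [h, hasSum_extend_zero injective_card_pow]
  exact (summable_carlitzExp x).hasSum

theorem coeff_zero_carlitzSeries : PowerSeries.coeff 0 (carlitzSeries F) = 0 := by
  rw [carlitzSeries, PowerSeries.coeff_mk, Function.extend_apply']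
  · rfl
  · rintro ⟨i, hi⟩
    exact (pow_pos Fintype.card_pos i).ne' hi

theorem theta_mem {L : Subfield (CInf F)} (hL : (ofK F).fieldRange ≤ L) : theta F ∈ L :=
  hL ⟨algebraMap F[X] (RatFunc F) Polynomial.X, rfl⟩

theorem carlitzCoeff_mem {L : Subfield (CInf F)} (hL : (ofK F).fieldRange ≤ L) (i : ℕ) :
    carlitzCoeff F i ∈ L := by
  induction i with
  | zero => exact L.one_mem
  | succ i ih =>
    exact div_mem (pow_mem ih _) (sub_mem (pow_mem (theta_mem hL) _) (theta_mem hL))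

theorem coeff_carlitzSeries_pow_mem {L : Subfield (CInf F)} (hL : (ofK F).fieldRange ≤ L)
    (m i : ℕ) : PowerSeries.coeff m (carlitzSeries F ^ i) ∈ L := by
  have h0 : ∀ n, PowerSeries.coeff n (carlitzSeries F) ∈ L := by
    intro n
    rw [carlitzSeries, PowerSeries.coeff_mk]
    by_cases hn : ∃ i, Fintype.card F ^ i = n
    · obtain ⟨i, rfl⟩ := hn
      rw [injective_card_pow.extend_apply]
      exact carlitzCoeff_mem hL i
    · rw [Function.extend_apply' _ _ _ hn]
      exact L.zero_mem
  have h1 : carlitzSeries F = PowerSeries.map L.subtype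
      (PowerSeries.mk fun n => ⟨PowerSeries.coeff n (carlitzSeries F), h0 n⟩) := by
    ext n
    simp
  rw [h1, ← map_pow, PowerSeries.coeff_map]
  exact Subtype.property _

/-! ### Expansions at infinity -/

/-- `f` has near infinity an expansion in `u_N` with coefficients in `L`. -/
def IsUExpandable (π : CInf F) (N : F[X]) (L : Subfield (CInf F)) (f : Omega F → CInf F) : Prop :=
  ∃ a : ℕ → CInf F, (∀ n, a n ∈ L) ∧ ∃ ρ : ℝ, 0 < ρ ∧ ∀ z : Omega F, uParam π N z ≠ 0 →
    ‖uParam π N z‖ < ρ → HasSum (fun n => a n * uParam π N z ^ n) (f z)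

/-- Additivity of exp_C turns translation in z into a fractional linear change of u. -/
theorem uParam_add {π : CInf F} {N : F[X]} {z : Omega F} (hz : uParam π N z ≠ 0) {x : CInf F}
    (hx : (z : CInf F) + x ∈ Omega F) :
    uParam π N ⟨(z : CInf F) + x, hx⟩ =
      uParam π N z * (1 + uParam π N z * carlitzExp (π / ofA F N * x))⁻¹ := by
  have h1 : π * ((z : CInf F) + x) / ofA F N = π * (z : CInf F) / ofA F N + π / ofA F N * x := by
    ring
  have h2 : carlitzExp (π * (z : CInf F) / ofA F N) ≠ 0 := fun h => hz (by rw [uParam, h, inv_zero])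
  rw [uParam, uParam]
  dsimp only
  rw [h1, carlitzExp_add, ← mul_inv, mul_add, mul_one, mul_inv_cancel_left₀ h2]

theorem norm_one_add {y : CInf F} (hy : ‖y‖ < 1) : ‖1 + y‖ = 1 := by
  rw [IsUltrametricDist.norm_add_eq_max_of_norm_ne_norm (by rw [norm_one]; exact hy.ne'),
    norm_one, max_eq_left hy.le]

theorem summable_of_norm_le {f g : ℕ → CInf F} (hf : Summable f) (h : ∀ n, ‖g n‖ ≤ ‖f n‖) :
    Summable g := by
  rw [NonarchimedeanAddGroup.summable_iff_tendsto_cofinite_zero] at hf ⊢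
  exact squeeze_zero_norm h (tendsto_zero_iff_norm_tendsto_zero.1 hf)

theorem hasPowerSeries_inv_one_add_pow (n : ℕ) :
    HasPowerSeries 1 (fun y : CInf F => ((1 + y)⁻¹) ^ n) (geomSeries (-1) ^ n) := by
  have h := (HasPowerSeries.inv_add (𝕜 := CInf F) one_ne_zero).pow n
  rw [norm_one] at h
  simpa [geomSeries] using h

/-- The coefficients of `∑ aₙ uⁿ (1 + y)⁻ⁿ` as a power series in `y`. -/
def uCoeff (a : ℕ → CInf F) (u : CInf F) (i : ℕ) : CInf F :=
  ∑' n, ((n + i - 1).choose i : CInf F) * (-1) ^ i * a n * u ^ n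

theorem summable_uCoeff {a : ℕ → CInf F} {u : CInf F} (h : Summable fun n => a n * u ^ n)
    (i : ℕ) :
    Summable fun n => ((n + i - 1).choose i : CInf F) * (-1) ^ i * a n * u ^ n := by
  refine summable_of_norm_le h fun n => ?_
  rw [mul_assoc, norm_mul, norm_mul _ ((-1) ^ i)]
  refine mul_le_of_le_one_left (norm_nonneg _) ?_
  rw [norm_pow, norm_neg, norm_one, one_pow, mul_one]
  exact IsUltrametricDist.norm_natCast_le_one _ _

/-- As |1 + y| = 1, the terms are bounded by |a_n u^n| uniformly in y, so each (1+y)^{-n} may be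
expanded and the sums exchanged. -/
theorem hasPowerSeries_uCoeff {a : ℕ → CInf F} {u : CInf F} (h : Summable fun n => a n * u ^ n) :
    HasPowerSeries 1 (fun y => ∑' n, a n * (u * (1 + y)⁻¹) ^ n)
      (PowerSeries.mk (uCoeff a u)) := by
  have hb : ∀ (n : ℕ) (y : CInf F), ‖y‖ < 1 → ‖a n * u ^ n * (1 + y)⁻¹ ^ n‖ ≤ ‖a n * u ^ n‖ := by
    intro n y hy
    rw [norm_mul, norm_pow, norm_inv, norm_one_add hy]
    simp
  obtain ⟨c, hc, hG⟩ := HasPowerSeries.hasSum (ringChar F)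
    (H := fun n y => a n * u ^ n * (1 + y)⁻¹ ^ n) (B := fun n => ‖a n * u ^ n‖)
    (fun n => (hasPowerSeries_inv_one_add_pow n).const_mul (a n * u ^ n)) hb
    (tendsto_zero_iff_norm_tendsto_zero.1 h.tendsto_atTop_zero)
    (G := fun y => ∑' n, a n * (u * (1 + y)⁻¹) ^ n)
    (fun y hy => by
      have h1 := (summable_of_norm_le h fun n => hb n y hy).hasSum
      simpa only [mul_pow, mul_assoc] using h1)
    (exists_ne_zero_norm_lt one_pos)
  convert hG using 1
  ext i
  rw [PowerSeries.coeff_mk, uCoeff, ← (hc i).tsum_eq]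
  refine tsum_congr fun n => ?_
  rw [PowerSeries.coeff_C_mul, coeff_geomSeries_pow]
  ring

/-- Hyperderivatives in terms of expansions at infinity. -/
theorem hyperDeriv_eq_sum_uCoeff {π : CInf F} {N : F[X]} {f : Omega F → CInf F} {a : ℕ → CInf F}
    {ρ : ℝ} (h : ∀ z : Omega F, uParam π N z ≠ 0 → ‖uParam π N z‖ < ρ →
      HasSum (fun n => a n * uParam π N z ^ n) (f z))
    {z : Omega F} (hz : uParam π N z ≠ 0) (hzρ : ‖uParam π N z‖ < ρ) (m : ℕ) :
    hyperDeriv m f z = ∑ i ∈ Finset.range (m + 1),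
      uCoeff a (uParam π N z) i * (uParam π N z ^ i *
        ((π / ofA F N) ^ m * PowerSeries.coeff m (carlitzSeries F ^ i))) := by
  set u := uParam π N z with hu
  have hE : HasPowerSeries 1 (fun x => u * carlitzExp (π / ofA F N * x))
      (PowerSeries.C u * PowerSeries.rescale (π / ofA F N) (carlitzSeries F)) :=
    HasPowerSeries.const_mul u ((hasPowerSeries_carlitzExp (‖π / ofA F N‖ + 1)).comp_mul
      fun x hx => by
        rw [norm_mul]
        have := mul_le_of_le_one_right (norm_nonneg (π / ofA F N)) hx.le
        linarith)
  have hE0 : PowerSeries.coeff 0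
      (PowerSeries.C u * PowerSeries.rescale (π / ofA F N) (carlitzSeries F)) = 0 := by
    rw [PowerSeries.coeff_C_mul, PowerSeries.coeff_rescale, coeff_zero_carlitzSeries]
    simp
  obtain ⟨ρ', h1, -, h2, h3⟩ := HasPowerSeries.exists_comp one_pos one_pos
    (hasPowerSeries_uCoeff (h z hz hzρ).summable) hE hE0
  obtain ⟨M, hM, hzM⟩ := exists_mem_affinoid z.2
  have hρ : 0 < min ρ' ((Fintype.card F : ℝ) ^ M)⁻¹ := lt_min h1 (radius_pos F M)
  rw [hyperDeriv_eq_coeff hρ ((h3.mono (min_le_left _ _)).congr fun x hx => ?_) m]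
  · rw [compSeries, PowerSeries.coeff_mk]
    refine Finset.sum_congr rfl fun i _ => ?_
    rw [PowerSeries.coeff_mk, mul_pow, ← map_pow, ← map_pow, PowerSeries.coeff_C_mul,
      PowerSeries.coeff_rescale]
  · rw [lt_min_iff] at hx
    have hΩ := affinoid_subset_Omega (add_mem_affinoid hzM hx.2)
    have hu1 := norm_one_add (h2 x hx.1)
    have hux := uParam_add hz hΩ
    have hne : 1 + u * carlitzExp (π / ofA F N * x) ≠ 0 :=
      norm_pos_iff.1 (by rw [hu1]; exact one_pos)
    -- Small translations preserve |u|, so the expansion at infinity stays valid at z + x.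
    rw [extendZero_of_mem _ hΩ, ← (h ⟨_, hΩ⟩ ?_ ?_).tsum_eq, hux]
    · rw [hux]
      exact mul_ne_zero hz (inv_ne_zero hne)
    · rw [hux, norm_mul, norm_inv, hu1, inv_one, mul_one]
      exact hzρ

namespace IsUExpandable

variable {π : CInf F} {N : F[X]} {L : Subfield (CInf F)} {f g : Omega F → CInf F}

theorem congr (hf : IsUExpandable π N L f) {ρ : ℝ} (hρ : 0 < ρ)
    (h : ∀ z : Omega F, uParam π N z ≠ 0 → ‖uParam π N z‖ < ρ → g z = f z) :
    IsUExpandable π N L g := by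
  obtain ⟨a, ha, ρ', hρ', h'⟩ := hf
  refine ⟨a, ha, min ρ ρ', lt_min hρ hρ', fun z hz hzρ => ?_⟩
  rw [lt_min_iff] at hzρ
  rw [h z hz hzρ.1]
  exact h' z hz hzρ.2

theorem const {c : CInf F} (hc : c ∈ L) : IsUExpandable π N L fun _ => c := by
  refine ⟨fun n => if n = 0 then c else 0, fun n => ?_, 1, one_pos, fun z _ _ => ?_⟩
  · dsimp only
    split_ifs
    · exact hc
    · exact L.zero_mem
  · have := hasSum_single (f := fun n => (if n = 0 then c else 0) * uParam π N z ^ n) 0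
      (fun n hn => by simp [hn])
    simpa using this

theorem uParam_pow (i : ℕ) : IsUExpandable π N L fun z => uParam π N z ^ i := by
  refine ⟨fun n => if n = i then 1 else 0, fun n => ?_, 1, one_pos, fun z _ _ => ?_⟩
  · dsimp only
    split_ifs
    · exact L.one_mem
    · exact L.zero_mem
  · have := hasSum_single (f := fun n => (if n = i then 1 else 0) * uParam π N z ^ n) i
      (fun n hn => by simp [hn])
    simpa using this

theorem add (hf : IsUExpandable π N L f) (hg : IsUExpandable π N L g) :
    IsUExpandable π N L fun z => f z + g z := by
  obtain ⟨a, ha, ρ, hρ, h⟩ := hf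
  obtain ⟨b, hb, ρ', hρ', h'⟩ := hg
  refine ⟨fun n => a n + b n, fun n => add_mem (ha n) (hb n), min ρ ρ', lt_min hρ hρ',
    fun z hz hzρ => ?_⟩
  rw [lt_min_iff] at hzρ
  simpa only [add_mul] using (h z hz hzρ.1).add (h' z hz hzρ.2)

theorem mul (hf : IsUExpandable π N L f) (hg : IsUExpandable π N L g) :
    IsUExpandable π N L fun z => f z * g z := by
  obtain ⟨a, ha, ρ, hρ, h⟩ := hf
  obtain ⟨b, hb, ρ', hρ', h'⟩ := hg
  refine ⟨fun n => ∑ y ∈ Finset.HasAntidiagonal.antidiagonal n, a y.1 * b y.2,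
    fun n => sum_mem fun y _ => mul_mem (ha _) (hb _), min ρ ρ', lt_min hρ hρ',
    fun z hz hzρ => ?_⟩
  rw [lt_min_iff] at hzρ
  convert hasSum_mul_antidiagonal (h z hz hzρ.1) (h' z hz hzρ.2) using 1
  funext n
  rw [Finset.sum_mul]
  refine Finset.sum_congr rfl fun y hy => ?_
  rw [← Finset.HasAntidiagonal.mem_antidiagonal.1 hy]
  ring

theorem sum {ι : Type*} (s : Finset ι) {f : ι → Omega F → CInf F}
    (hf : ∀ i ∈ s, IsUExpandable π N L (f i)) : IsUExpandable π N L fun z => ∑ i ∈ s, f i z := by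
  classical
  induction s using Finset.induction_on with
  | empty => simpa using const (π := π) (N := N) L.zero_mem
  | insert a s ha ih =>
    simp only [Finset.sum_insert ha]
    exact (hf a (Finset.mem_insert_self a s)).add
      (ih fun i hi => hf i (Finset.mem_insert_of_mem hi))

/-- Each `uCoeff` is itself a u-series whose coefficients are integer multiples of those of f. The
other constants are N^{-m} and coefficients of powers of exp_C, all in K. -/
theorem der (hL : (ofK F).fieldRange ≤ L) (hf : IsUExpandable π N L f) (m : ℕ) :
    IsUExpandable π N L (der π m f) := by
  obtain ⟨a, ha, ρ, hρ, h⟩ := hf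
  have hg : ∀ i, IsUExpandable π N L fun z => uCoeff a (uParam π N z) i := fun i =>
    ⟨fun n => ((n + i - 1).choose i : CInf F) * (-1) ^ i * a n,
      fun n => mul_mem (mul_mem (natCast_mem L _) (pow_mem (neg_mem L.one_mem) _)) (ha n), ρ, hρ,
      fun z hz hzρ => (summable_uCoeff (h z hz hzρ).summable i).hasSum⟩
  -- The π^m from the chain rule meets the normalisation of ∂^m; the quotient is 0 or 1.
  have hπ : π ^ m / π ^ m ∈ L := by
    rcases eq_or_ne (π ^ m) 0 with h0 | h0
    · rw [h0, div_zero]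
      exact L.zero_mem
    · rw [div_self h0]
      exact L.one_mem
  have hN : ofA F N ∈ L := hL ⟨algebraMap F[X] (RatFunc F) N, rfl⟩
  have hκ : ∀ i, π ^ m / π ^ m * (ofA F N ^ m)⁻¹ * PowerSeries.coeff m (carlitzSeries F ^ i) ∈ L :=
    fun i => mul_mem (mul_mem hπ (inv_mem (pow_mem hN m))) (coeff_carlitzSeries_pow_mem hL m i)
  refine (sum (Finset.range (m + 1)) fun i _ =>
    (hg i).mul ((uParam_pow i).mul (const (hκ i)))).congr hρ fun z hz hzρ => ?_
  rw [Drinfeld.der, hyperDeriv_eq_sum_uCoeff h hz hzρ, Finset.sum_div]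
  refine Finset.sum_congr rfl fun i _ => ?_
  rw [div_pow]
  ring

theorem rankinCohen (hL : (ofK F).fieldRange ≤ L) (hf : IsUExpandable π N L f)
    (hg : IsUExpandable π N L g) (k w r : ℕ) :
    IsUExpandable π N L (rankinCohen π k w r f g) :=
  sum _ fun _ _ => (const (mul_mem (pow_mem (neg_mem L.one_mem) _) (natCast_mem L _))).mul
    ((hf.der hL _).mul (hg.der hL _))

end IsUExpandable

/-! ### Brackets of modular forms -/

/-- Since the bracket commutes with slashing, invariance is immediate, and the condition for each α
reduces to bracketing the expansions of f|α and g|α, with all of ℂ∞ as coefficient field. -/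
theorem IsDrinfeldModularForm.rankinCohen {π : CInf F} {Γ : Subgroup (GL (Fin 2) F[X])}
    {k w : ℕ} {m₁ m₂ : ZMod (Fintype.card F - 1)} {f g : Omega F → CInf F}
    (hf : IsDrinfeldModularForm π k m₁ Γ f) (hg : IsDrinfeldModularForm π w m₂ Γ g) (r : ℕ) :
    IsDrinfeldModularForm π (k + w + 2 * r) (m₁ + m₂ + r) Γ (rankinCohen π k w r f g) where
  holomorphic := hf.holomorphic.rankinCohen hg.holomorphic π k w r
  slash_eq γ hγ := by
    rw [← rankinCohen_slash π hf.holomorphic hg.holomorphic, hf.slash_eq γ hγ, hg.slash_eq γ hγ]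
  holomorphic_at_infinity α := by
    obtain ⟨a, ha⟩ := hf.holomorphic_at_infinity α
    obtain ⟨b, hb⟩ := hg.holomorphic_at_infinity α
    rw [← rankinCohen_slash π hf.holomorphic hg.holomorphic]
    have hfe : IsUExpandable π (mGamma (conjBy Γ α)) ⊤ (slash k m₁ f α) :=
      ⟨a, fun _ => trivial, ha⟩
    have hge : IsUExpandable π (mGamma (conjBy Γ α)) ⊤ (slash w m₂ g α) :=
      ⟨b, fun _ => trivial, hb⟩
    obtain ⟨c, -, hc⟩ := hfe.rankinCohen le_top hge k w r
    exact ⟨c, hc⟩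

theorem isHolomorphic_of_mem_modularForms {π : CInf F} {k : ℤ} {m : ZMod (Fintype.card F - 1)}
    {Γ : Subgroup (GL (Fin 2) F[X])} {L : Subfield (CInf F)} {f : Omega F → CInf F}
    (hf : f ∈ ModularForms π k m Γ L) : IsHolomorphic f := by
  induction hf using Submodule.span_induction with
  | mem f hf => exact hf.1.holomorphic
  | zero => exact IsHolomorphic.const 0
  | add f g _ _ hf hg => exact hf.add hg
  | smul c f _ hf => exact (IsHolomorphic.const (c : CInf F)).mul hf

/-! ### Bilinearity of the bracket on holomorphic functions -/

section Bilinear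

variable {f f' g g' : Omega F → CInf F}

theorem rankinCohen_add_left (π : CInf F) (k w r : ℕ) (hf : IsHolomorphic f)
    (hf' : IsHolomorphic f') :
    rankinCohen π k w r (f + f') g = rankinCohen π k w r f g + rankinCohen π k w r f' g := by
  funext z
  rw [Pi.add_apply, rankinCohen, rankinCohen, rankinCohen, ← Finset.sum_add_distrib]
  refine Finset.sum_congr rfl fun ν _ => ?_
  have h : hyperDeriv ν (f + f') z = hyperDeriv ν f z + hyperDeriv ν f' z :=
    hf.hyperDeriv_add hf' ν z
  simp only [der, h]
  ring

theorem rankinCohen_add_right (π : CInf F) (k w r : ℕ) (hg : IsHolomorphic g)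
    (hg' : IsHolomorphic g') :
    rankinCohen π k w r f (g + g') = rankinCohen π k w r f g + rankinCohen π k w r f g' := by
  funext z
  rw [Pi.add_apply, rankinCohen, rankinCohen, rankinCohen, ← Finset.sum_add_distrib]
  refine Finset.sum_congr rfl fun ν _ => ?_
  have h : hyperDeriv (r - ν) (g + g') z = hyperDeriv (r - ν) g z + hyperDeriv (r - ν) g' z :=
    hg.hyperDeriv_add hg' (r - ν) z
  simp only [der, h]
  ring

variable {L : Subfield (CInf F)}

theorem rankinCohen_smul_left (π : CInf F) (k w r : ℕ) (hf : IsHolomorphic f) (c : L) :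
    rankinCohen π k w r (c • f) g = c • rankinCohen π k w r f g := by
  funext z
  have h1 : (c • rankinCohen π k w r f g) z = (c : CInf F) * rankinCohen π k w r f g z := rfl
  rw [h1, rankinCohen, rankinCohen, Finset.mul_sum]
  refine Finset.sum_congr rfl fun ν _ => ?_
  have h : hyperDeriv ν (c • f) z = c * hyperDeriv ν f z := hf.hyperDeriv_const_mul (c : CInf F) ν z
  simp only [der, h]
  ring

theorem rankinCohen_smul_right (π : CInf F) (k w r : ℕ) (hg : IsHolomorphic g) (c : L) :
    rankinCohen π k w r f (c • g) = c • rankinCohen π k w r f g := by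
  funext z
  have h1 : (c • rankinCohen π k w r f g) z = (c : CInf F) * rankinCohen π k w r f g z := rfl
  rw [h1, rankinCohen, rankinCohen, Finset.mul_sum]
  refine Finset.sum_congr rfl fun ν _ => ?_
  have h : hyperDeriv (r - ν) (c • g) z = c * hyperDeriv (r - ν) g z :=
    hg.hyperDeriv_const_mul (c : CInf F) (r - ν) z
  simp only [der, h]
  ring

end Bilinear

theorem rankinCohen_mem_modularForms {π : CInf F} {Γ : Subgroup (GL (Fin 2) F[X])}
    {L : Subfield (CInf F)} (hL : (ofK F).fieldRange ≤ L) {k w : ℕ}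
    {m₁ m₂ : ZMod (Fintype.card F - 1)} {f g : Omega F → CInf F}
    (hf : f ∈ ModularForms π k m₁ Γ L) (hg : g ∈ ModularForms π w m₂ Γ L) (r : ℕ) :
    rankinCohen π k w r f g ∈ ModularForms π (k + w + 2 * r) (m₁ + m₂ + r) Γ L := by
  induction hf, hg using Submodule.span_induction₂ with
  | mem_mem f g hf hg =>
    obtain ⟨hf, a, ha, hfa⟩ := hf
    obtain ⟨hg, b, hb, hgb⟩ := hg
    have hfe : IsUExpandable π (mGamma Γ) L f := ⟨a, ha, hfa⟩
    have hge : IsUExpandable π (mGamma Γ) L g := ⟨b, hb, hgb⟩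
    exact Submodule.subset_span ⟨hf.rankinCohen hg r, hfe.rankinCohen hL hge k w r⟩
  | zero_left g _ =>
    -- The zero function is treated as 0 times itself, so homogeneity gives a zero bracket.
    have h := rankinCohen_smul_left (g := g) π k w r (IsHolomorphic.const 0) (0 : L)
    rw [zero_smul, zero_smul] at h
    rw [h]
    exact zero_mem _
  | zero_right f _ =>
    have h := rankinCohen_smul_right (f := f) π k w r (IsHolomorphic.const 0) (0 : L)
    rw [zero_smul, zero_smul] at h
    rw [h]
    exact zero_mem _
  | add_left f f' g hf hf' _ h h' =>
    rw [rankinCohen_add_left π k w r (isHolomorphic_of_mem_modularForms hf)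
      (isHolomorphic_of_mem_modularForms hf')]
    exact add_mem h h'
  | add_right f g g' _ hg hg' h h' =>
    rw [rankinCohen_add_right π k w r (isHolomorphic_of_mem_modularForms hg)
      (isHolomorphic_of_mem_modularForms hg')]
    exact add_mem h h'
  | smul_left c f g hf _ h =>
    rw [rankinCohen_smul_left π k w r (isHolomorphic_of_mem_modularForms hf)]
    exact Submodule.smul_mem _ c h
  | smul_right c f g _ hg h =>
    rw [rankinCohen_smul_right π k w r (isHolomorphic_of_mem_modularForms hg)]
    exact Submodule.smul_mem _ c h

end Drinfeld

end

theorem mainTheorem6 {F : Type*} [Field F] [Fintype F]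
    (π : Drinfeld.CInf F) (hπ : Drinfeld.IsCarlitzPeriod π) (k w r : ℕ) :
    (∀ (M : Subfield (Drinfeld.CInf F))
        (ψ : Drinfeld.CInf F ≃ₐ[Drinfeld.KInf F] Drinfeld.CInf F),
      Drinfeld.unramifiedCompletion F ⊆ M → Drinfeld.IsExtensionOfFrobenius ψ →
      ∀ f g : Drinfeld.Omega F → Drinfeld.CInf F,
        Drinfeld.IsHolomorphic f → Drinfeld.IsHolomorphic g →
        ∀ z : Drinfeld.OmegaPsi M ψ,
          Drinfeld.rankinCohen π k w r f g (Drinfeld.toOmega z) =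
            ∑ ν ∈ Finset.range (r + 1),
              (-1) ^ (r - ν) * (Drinfeld.beta k w r ν : Drinfeld.CInf F) *
                (Drinfeld.maassShimura π k ν f z * Drinfeld.maassShimura π w (r - ν) g z)) ∧
    (∀ Γ : Subgroup (GL (Fin 2) (Polynomial F)), Drinfeld.IsCongruence Γ →
      ∀ L : Subfield (Drinfeld.CInf F), (Drinfeld.ofK F).fieldRange ≤ L →
      ∀ (m₁ m₂ : ZMod (Fintype.card F - 1)) (f g : Drinfeld.Omega F → Drinfeld.CInf F),
        f ∈ Drinfeld.ModularForms π k m₁ Γ L → g ∈ Drinfeld.ModularForms π w m₂ Γ L →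
        Drinfeld.rankinCohen π k w r f g ∈
          Drinfeld.ModularForms π (k + w + 2 * r) (m₁ + m₂ + r) Γ L) := by
  refine ⟨fun M ψ _ _ f g hf hg z => ?_, fun Γ _ L hL m₁ m₂ f g hf hg => ?_⟩
  · exact Drinfeld.rankinCohen_eq_sum_maassShimura k w r hf hg z
  · exact Drinfeld.rankinCohen_mem_modularForms hL hf hg r
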